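/- **Model.** Fix $q>0$ and $\eta>0$. Knowledge is a nonempty finite set $K=\{x_1<\dots<x_k\}\subset\mathbb R$ of questions whose answers are known, the answers being values of a standard Brownian motion on $\mathbb R$. The conjecture about the answer to question $x$ has variance $\sigma^2_x(K)=x_1-x$ if $x<x_1$, $\sigma^2_x(K)=\frac{(x_{i+1}-x)(x-x_i)}{x_{i+1}-x_i}$ if $x\in[x_i,x_{i+1})$ with $1\le i<k$, and $\sigma^2_x(K)=x-x_k$ if $x\ge x_k$. The value of knowledge is $v(K)=\int_{\mathbb R}\max\{\frac{q-\sigma^2_x(K)}{q},0\}\,dx$, and the benefit of discovering the answer to $x$ is $V_K(x)=v(K\cup\{x\})-v(K)$. The novelty of $x$ is its distance $d=\min_i|x-x_i|$ to $K$. A researcher who chooses question $x$ and output (probability of discovery) $\rho\in[0,1]$ has payoff $$\rho\,V_K(x)-\eta\,\tilde c(\rho)\,\sigma^2_x(K),\qquad \tilde c(\rho)=(\operatorname{erf}^{-1}(\rho))^2 \text{ for } \rho<1,\quad \tilde c(1)=\infty .$$ The areas of $K$ are $(-\infty,x_1)$ and $[x_k,\infty)$ (research there expands knowledge) and the intervals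 $[x_i,x_{i+1})$, $1\le i<k$, of length $X=x_{i+1}-x_i$ (research there deepens knowledge; here $0\le d\le X/2$). Within a given area, for novelty $d>0$ in each of the ranges below, the payoff-maximizing output $\rho^*(d)$ on a question of novelty $d$ exists, is unique, and depends on the question only through $d$. On a range of $d$, novelty and output are called *substitutes*, *complements*, or *independent* if $\rho^*$ is there strictly decreasing, strictly increasing, or constant, respectively. An optimal choice in an area is a pair $(x,\rho)$, with $x$ in the area and $\rho\in[0,1]$, that maximizes the payoff over all such pairs. **Proposition.** 1. *Expanding knowledge.* In each of the areas $(-\infty,x_1)$ and $[x_k,\infty)$: (i) $d$ and $\rho$ are substitutes on $d\in(0,\infty)$; (ii) an optimal choice exists, and every optimal choice has $d\in(2q,3q)$. 2. *Deepening knowledge* in an area of length $X$. (i) $d$ and $\rho$ are (a) independent on $d\in(0,X/2]$ if $X\le 4q$; (b) complements on $d\in(0,X/2]$ if $4q<X<(4+\sqrt6)q$; (c) if $(4+\sqrt6)q<X<8q$: substitutes on $d\in(0,\hat d(X))$ and complements on $d\in(\hat d(X),X/2)$, where $$\hat d(X)=\frac{2}{X-6q}\left(X^2-6qX+6q^2-(X-2q)\sqrt{\frac{18q^2-8qX+X^2}{2}}\right)\in(0,X/2);$$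 (d) substitutes on $d\in(0,X/2]$ if $X>8q$. (ii) There is a cutoff $\widetilde X\in(4q,8q)$, depending only on $q$ and $\eta$, such that in every area of every finite length $X$ (for every knowledge $K$) an optimal choice exists, and: if $X\le\widetilde X$, the midpoint $d=X/2$ is an optimal distance (together with a suitable $\rho$), and it is the only optimal distance if $X<\widetilde X$; if $X>\widetilde X$, every optimal choice is interior, $0<d<X/2$. -/

import Mathlib

noncomputable section

namespace ResearchModel

/-- The error function `erf z = (2 / √π) ∫₀ᶻ exp (-t²) dt`. -/
def erf (z : ℝ) : ℝ := 2 / Real.sqrt Real.pi * ∫ t in (0 : ℝ)..z, Real.exp (-t ^ 2)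

/-- The inverse error function, meaningful on `(-1, 1)`, the range of the injective map `erf`. -/
def erfInv : ℝ → ℝ := Function.invFun erf

/-- The variance of the conjecture about the answer `Y x` to question `x`, where `Y` is a standard
Brownian motion on the whole line and `K` is the finite set of the questions with known answers:
`x₁ - x` to the left of all of `K`, `x - x_k` to the right of all of `K`, and
`(x_{i+1} - x) (x - x_i) / (x_{i+1} - x_i)` for `x_i ≤ x < x_{i+1}`.
The value for empty `K` is a placeholder. -/
def conjVar (K : Finset ℝ) (x : ℝ) : ℝ :=
  if hL : (K.filter (fun k => k ≤ x)).Nonempty then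
    if hR : (K.filter (fun k => x < k)).Nonempty then
      ((K.filter (fun k => x < k)).min' hR - x) * (x - (K.filter (fun k => k ≤ x)).max' hL) /
        ((K.filter (fun k => x < k)).min' hR - (K.filter (fun k => k ≤ x)).max' hL)
    else x - (K.filter (fun k => k ≤ x)).max' hL
  else
    if hR : (K.filter (fun k => x < k)).Nonempty then
      (K.filter (fun k => x < k)).min' hR - x
    else 0

/-- The value of knowledge to the decision maker with error tolerance `q`: on each question she
takes the better of the optimal proactive action, with expected payoff `(q - σ²) / q`, and the
outside option, with payoff `0`. -/
def knowledgeValue (q : ℝ) (K : Finset ℝ) : ℝ := ∫ x : ℝ, max ((q - conjVar K x) / q) 0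

/-- The benefit of discovering the answer to question `x` given knowledge `K`. -/
def benefit (q : ℝ) (K : Finset ℝ) (x : ℝ) : ℝ :=
  knowledgeValue q (insert x K) - knowledgeValue q K

/-- The novelty `d` of question `x`: its distance to existing knowledge. -/
def novelty (K : Finset ℝ) (x : ℝ) : ℝ := Metric.infDist x (K : Set ℝ)

/-- The cost factor `(erf⁻¹ ρ)²` for `ρ < 1`, with the value `∞` at `ρ = 1`. -/
def costFactor (ρ : ℝ) : EReal := if ρ < 1 then ((erfInv ρ ^ 2 : ℝ) : EReal) else ⊤

/-- The researcher's payoff `ρ V - η (erf⁻¹ ρ)² σ²` from question `x` and output `ρ`. -/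
def payoff (q η : ℝ) (K : Finset ℝ) (x ρ : ℝ) : EReal :=
  ((ρ * benefit q K x : ℝ) : EReal) - (η : EReal) * (costFactor ρ * (conjVar K x : EReal))

/-- The outputs `ρ ∈ [0, 1]` that maximize the researcher's payoff on the given question `x`. -/
def bestOutputs (q η : ℝ) (K : Finset ℝ) (x : ℝ) : Set ℝ :=
  {ρ | ρ ∈ Set.Icc (0 : ℝ) 1 ∧ IsMaxOn (fun ρ' => payoff q η K x ρ') (Set.Icc 0 1) ρ}

/-- On the questions of the area `A` with novelty in `S` there is exactly one optimal output, and it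
depends on the question only through the novelty `d`: it is `r d`. -/
def IsOptimalOutput (q η : ℝ) (K : Finset ℝ) (A S : Set ℝ) (r : ℝ → ℝ) : Prop :=
  ∀ x ∈ A, novelty K x ∈ S → bestOutputs q η K x = {r (novelty K x)}

/-- In area `A`, output is strictly decreasing in novelty for novelty in `S`. -/
def Substitutes (q η : ℝ) (K : Finset ℝ) (A S : Set ℝ) : Prop :=
  ∃ r : ℝ → ℝ, IsOptimalOutput q η K A S r ∧ StrictAntiOn r S

/-- In area `A`, output is strictly increasing in novelty for novelty in `S`. -/
def Complements (q η : ℝ) (K : Finset ℝ) (A S : Set ℝ) : Prop :=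
  ∃ r : ℝ → ℝ, IsOptimalOutput q η K A S r ∧ StrictMonoOn r S

/-- In area `A`, output does not vary with novelty for novelty in `S`. -/
def Independent (q η : ℝ) (K : Finset ℝ) (A S : Set ℝ) : Prop :=
  ∃ r : ℝ → ℝ, IsOptimalOutput q η K A S r ∧ ∀ d ∈ S, ∀ d' ∈ S, r d = r d'

/-- `(x, ρ)` is an optimal choice of the researcher within area `A`. -/
def IsOptimalChoice (q η : ℝ) (K : Finset ℝ) (A : Set ℝ) (x ρ : ℝ) : Prop :=
  (x ∈ A ∧ ρ ∈ Set.Icc (0 : ℝ) 1) ∧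
    IsMaxOn (fun p : ℝ × ℝ => payoff q η K p.1 p.2) (A ×ˢ Set.Icc (0 : ℝ) 1) (x, ρ)

/-- `A` is one of the two areas beyond the frontier, `(-∞, x₁)` or `[x_k, ∞)`. Research in such an
area expands knowledge. -/
def IsFrontierArea (K : Finset ℝ) (A : Set ℝ) : Prop :=
  ∃ hK : K.Nonempty, A = Set.Iio (K.min' hK) ∨ A = Set.Ici (K.max' hK)

/-- `A` is an area `[x_i, x_{i+1})` between adjacent elements of `K`, of length `X`. Research in
such an area deepens knowledge. -/
def IsBoundedArea (K : Finset ℝ) (A : Set ℝ) (X : ℝ) : Prop :=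
  ∃ l ∈ K, ∃ r ∈ K, l < r ∧ (∀ k ∈ K, k ≤ l ∨ r ≤ k) ∧ A = Set.Ico l r ∧ X = r - l

/-- The cutoff `d̂(X)` at which novelty and output switch from substitutes to complements. -/
def dHat (q X : ℝ) : ℝ :=
  2 / (X - 6 * q) *
    ((X ^ 2 - 6 * q * X + 6 * q ^ 2) -
      (X - 2 * q) * Real.sqrt ((18 * q ^ 2 - 8 * q * X + X ^ 2) / 2))

end ResearchModel

end

open ResearchModel

/-! Everything scales with `q`, so the analysis is done for tolerance 1. Let `v = intervalValue`,
the integral of the gain over an interval between two known answers. Splitting an interval of length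
`X` at distance `d` is worth `v d + v (X - d) - v X`; going `d` beyond the frontier is worth `v d`.

Write `ρ = erf z`. The payoff is the variance `S` times `erf z * R - η z²`, where `R` is benefit
over variance. The first-order condition is `R = √π η z exp (z²)`, whose right side is an increasing
bijection of the line. The optimal output is therefore a strictly increasing function of `R`, and
substitutes, complements and independence say how `R` varies with `d`. Beyond the frontier `R = v d
/ d`, which is strictly decreasing. In a bounded area `R` is the constant `X / 3` up to length 4.
For longer intervals the sign of its slope, when the nearer part is at most 4 and the farther one
exceeds 4, is that of the quadratic `switchQuad`, which is concave in `X - d`; the thresholds `4 +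
√6` and `8` and the root `dHat` are read off from it. When both parts exceed 4, a polynomial
inequality with positive coefficients settles the sign (`slope_polynomial`).

Beyond the frontier, the envelope argument gives a first-order condition in `d`; it forces `d < 3`,
and together with `lt_erf` it forces `d > 2` (`max_frontierPayoff_mem`).

The cutoff rests on single crossing (`beats_mid_of_lt`). The best payoff is `S * f R` with `f =
optValue`, and `f` is strictly log-concave, again by `lt_erf`. Hold the relative position fixed and
lengthen the interval, up to 8. Once a position matches the midpoint, its lead in `R` does not
shrink, while `R` at the midpoint falls; log-concavity then makes the relative lead in `f` grow. The
cutoff is the infimum of the lengths up to 8 at which some position beats the midpoint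
(`exists_cutoff`). -/

namespace ResearchModel

/-! ### The value of an interval and the ratio of benefit to variance, for tolerance 1. -/

/-- The square root `√(t (t - 4))`, which vanishes on `[0, 4]`. -/
noncomputable def gapRoot (t : ℝ) : ℝ := Real.sqrt (t * (t - 4))

/-- The function `(t - 4) √(t (t - 4))`, which vanishes on `[0, 4]`. -/
noncomputable def excess (t : ℝ) : ℝ := (t - 4) * gapRoot t

/-- The value of an interval of length `t` between two known answers, for error tolerance `1`. -/
noncomputable def intervalValue (t : ℝ) : ℝ := t - t ^ 2 / 6 + excess t / 6

/-- The benefit of splitting an interval of length `X` at distance `d` from an endpoint. -/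
noncomputable def splitValue (d X : ℝ) : ℝ :=
  intervalValue d + intervalValue (X - d) - intervalValue X

/-- The variance at distance `d` from an endpoint of an interval of length `X`. -/
noncomputable def bridgeVar (d X : ℝ) : ℝ := d * (X - d) / X

/-- The benefit per unit of variance in an interval of length `X`. -/
noncomputable def splitRatio (d X : ℝ) : ℝ := splitValue d X / bridgeVar d X

/-- A quadratic in `y = X - d` whose sign is that of the slope of `splitRatio` for `d ≤ 4`. -/
noncomputable def switchQuad (y X : ℝ) : ℝ :=
  X * (X - 4) ^ 3 + (16 - 2 * (X - 4) ^ 3) * y - (X - 6) ^ 2 * y ^ 2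

lemma gapRoot_nonneg (t : ℝ) : 0 ≤ gapRoot t := Real.sqrt_nonneg _

lemma gapRoot_of_le {t : ℝ} (h0 : 0 ≤ t) (h4 : t ≤ 4) : gapRoot t = 0 :=
  Real.sqrt_eq_zero_of_nonpos (by nlinarith)

lemma gapRoot_sq {t : ℝ} (h4 : 4 ≤ t) : gapRoot t ^ 2 = t * (t - 4) :=
  Real.sq_sqrt (by nlinarith)

lemma gapRoot_pos {t : ℝ} (h4 : 4 < t) : 0 < gapRoot t :=
  Real.sqrt_pos.2 (by nlinarith)

lemma continuous_gapRoot : Continuous gapRoot := by unfold gapRoot; fun_prop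

lemma continuous_excess : Continuous excess := by
  have := continuous_gapRoot
  unfold excess; fun_prop

lemma continuous_intervalValue : Continuous intervalValue := by
  have := continuous_excess
  unfold intervalValue; fun_prop

lemma excess_of_le {t : ℝ} (h0 : 0 ≤ t) (h4 : t ≤ 4) : excess t = 0 := by
  simp [excess, gapRoot_of_le h0 h4]

lemma excess_pos {t : ℝ} (h4 : 4 < t) : 0 < excess t :=
  mul_pos (by linarith) (gapRoot_pos h4)

lemma hasDerivAt_gapRoot {t : ℝ} (h4 : 4 < t) :
    HasDerivAt gapRoot ((t - 2) / gapRoot t) t := by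
  have h : HasDerivAt (fun t : ℝ => t * (t - 4)) (1 * (t - 4) + t * 1) t :=
    (hasDerivAt_id' t).fun_mul ((hasDerivAt_id' t).sub_const 4)
  have h2 := h.sqrt (by nlinarith)
  refine h2.congr_deriv ?_
  rw [show 1 * (t - 4) + t * 1 = 2 * (t - 2) by ring]
  exact mul_div_mul_left _ _ two_ne_zero

lemma hasDerivAt_excess {t : ℝ} (h4 : 4 < t) :
    HasDerivAt excess (2 * (t - 1) * gapRoot t / t) t := by
  have h := ((hasDerivAt_id' t).sub_const 4).fun_mul (hasDerivAt_gapRoot h4)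
  refine h.congr_deriv ?_
  have h1 := gapRoot_pos h4
  have h2 := gapRoot_sq h4.le
  have : (0 : ℝ) < t := by linarith
  field_simp
  linear_combination (2 - t) * h2

lemma hasDerivAt_intervalValue {t : ℝ} (h4 : 4 < t) :
    HasDerivAt intervalValue (1 - t / 3 + (t - 1) * gapRoot t / (3 * t)) t := by
  have h := (((hasDerivAt_id' t).fun_sub (((hasDerivAt_id' t).fun_pow 2).div_const 6)).fun_add
    ((hasDerivAt_excess h4).div_const 6))
  refine h.congr_deriv ?_
  have : (0 : ℝ) < t := by linarith
  field_simp
  ring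

lemma intervalValue_of_le {t : ℝ} (h0 : 0 ≤ t) (h4 : t ≤ 4) :
    intervalValue t = t - t ^ 2 / 6 := by
  simp [intervalValue, excess_of_le h0 h4]

lemma intervalValue_le {t : ℝ} (h0 : 0 ≤ t) : intervalValue t ≤ 3 / 2 := by
  rcases le_total t 4 with h | h
  · rw [intervalValue_of_le h0 h]; nlinarith [sq_nonneg (t - 3)]
  -- From length 4 on, this bound caps the value at 4/3; the overall maximum 3/2 is attained at 3.
  · have h1 : gapRoot t ≤ t - 2 := by
      refine abs_le_of_sq_le_sq' ?_ (by linarith) |>.2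
      rw [gapRoot_sq h]; nlinarith
    unfold intervalValue excess
    nlinarith [mul_le_mul_of_nonneg_left h1 (by linarith : 0 ≤ t - 4)]

/-- The average value of an interval is strictly decreasing in its length. -/
lemma strictAntiOn_intervalValue_div :
    StrictAntiOn (fun t => intervalValue t / t) (Set.Ioi 0) := by
  have h1 : StrictAntiOn (fun t => intervalValue t / t) (Set.Ioc 0 4) := by
    intro a ha b hb hab
    have ha0 := ha.1
    have hb0 := hb.1
    simp only [intervalValue_of_le ha.1.le ha.2, intervalValue_of_le hb.1.le hb.2]
    have e : ∀ c : ℝ, 0 < c → (c - c ^ 2 / 6) / c = 1 - c / 6 := by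
      intro c hc; field_simp
    rw [e a ha0, e b hb0]; linarith
  have h2 : StrictAntiOn (fun t => intervalValue t / t) (Set.Ici 4) := by
    apply strictAntiOn_of_deriv_neg (convex_Ici 4)
    · exact continuous_intervalValue.continuousOn.div continuousOn_id
        (fun x hx => by have : (4 : ℝ) ≤ x := hx; simp; linarith)
    · intro t ht
      rw [interior_Ici] at ht
      have ht4 : (4 : ℝ) < t := ht
      have ht0 : (0 : ℝ) < t := by linarith
      rw [((hasDerivAt_intervalValue ht4).fun_div (hasDerivAt_id' t) ht0.ne').deriv]
      have hw := gapRoot_sq ht4.le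
      have hwp := gapRoot_pos ht4
      -- The numerator of the derivative is one sixth of the difference of these two sides.
      have : (t + 2) * gapRoot t < t ^ 2 := by
        refine abs_lt_of_sq_lt_sq' ?_ (by positivity) |>.2
        rw [mul_pow, hw]
        nlinarith [mul_pos ht0 ht0]
      apply div_neg_of_neg_of_pos _ (by positivity)
      simp only [intervalValue, excess]
      have e : (1 - t / 3 + (t - 1) * gapRoot t / (3 * t)) * t -
          (t - t ^ 2 / 6 + (t - 4) * gapRoot t / 6) * 1 = ((t + 2) * gapRoot t - t ^ 2) / 6 := by
        field_simp; ring
      rw [e]; linarith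
  have := h1.union h2 (c := 4) ⟨⟨by norm_num, le_rfl⟩, fun x hx => hx.2⟩
    ⟨Set.mem_Ici.2 le_rfl, fun x hx => hx⟩
  rwa [Set.Ioc_union_Ici_eq_Ioi (by norm_num)] at this

lemma intervalValue_pos {t : ℝ} (h0 : 0 < t) : 0 < intervalValue t := by
  rcases lt_or_ge t 6 with h | h
  · have h1 : 0 ≤ excess t := by
      rcases le_total t 4 with h4 | h4
      · rw [excess_of_le h0.le h4]
      · exact mul_nonneg (by linarith) (gapRoot_nonneg t)
    unfold intervalValue
    nlinarith
  · have h1 : t * (t - 6) < excess t := by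
      refine abs_lt_of_sq_lt_sq' ?_ (excess_pos (by linarith)).le |>.2
      unfold excess
      rw [mul_pow _ (gapRoot t), gapRoot_sq (by linarith)]
      nlinarith
    unfold intervalValue
    nlinarith

/-- A decreasing average makes the value strictly subadditive. -/
lemma splitValue_pos {d X : ℝ} (h0 : 0 < d) (h1 : d < X) : 0 < splitValue d X := by
  have hX : 0 < X := h0.trans h1
  have hy : 0 < X - d := by linarith
  have a := strictAntiOn_intervalValue_div (Set.mem_Ioi.2 h0) (Set.mem_Ioi.2 hX) h1
  have b := strictAntiOn_intervalValue_div (Set.mem_Ioi.2 hy) (Set.mem_Ioi.2 hX) (by linarith)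
  simp only at a b
  have a' := mul_lt_mul_of_pos_left a h0
  have b' := mul_lt_mul_of_pos_left b hy
  rw [mul_div_cancel₀ _ h0.ne'] at a'
  rw [mul_div_cancel₀ _ hy.ne'] at b'
  have e : d * (intervalValue X / X) + (X - d) * (intervalValue X / X) = intervalValue X := by
    field_simp; ring
  unfold splitValue; linarith

lemma bridgeVar_pos {d X : ℝ} (h0 : 0 < d) (h1 : d < X) : 0 < bridgeVar d X := by
  unfold bridgeVar
  have : 0 < X - d := by linarith
  have : 0 < X := by linarith
  positivity

lemma splitRatio_pos {d X : ℝ} (h0 : 0 < d) (h1 : d < X) : 0 < splitRatio d X :=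
  div_pos (splitValue_pos h0 h1) (bridgeVar_pos h0 h1)

/-- The linear terms of the value cancel and the quadratic ones contribute exactly `X / 3`, so only
the excess terms can make the ratio depend on `d`. -/
lemma splitRatio_eq {d X : ℝ} (h0 : 0 < d) (h1 : d < X) :
    splitRatio d X = X / 3 - X / 6 * ((excess X - excess d - excess (X - d)) / ((X - d) * d)) := by
  unfold splitRatio splitValue bridgeVar intervalValue
  have : 0 < X - d := by linarith
  have : 0 < X := by linarith
  field_simp
  ring

lemma splitRatio_of_le {d X : ℝ} (h0 : 0 < d) (h1 : d < X) (hX : X ≤ 4) :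
    splitRatio d X = X / 3 := by
  rw [splitRatio_eq h0 h1, excess_of_le h0.le (by linarith),
    excess_of_le (by linarith) hX, excess_of_le (by linarith) (by linarith)]
  simp

/-! ### How the ratio varies with the distance. -/

/-- The slope of the excess quotient has the sign of `switchQuad`. -/
lemma sign_switchQuad {y X : ℝ} (h4 : 4 < y) (hy : y < X) (h2 : X ≤ 2 * y) :
    (0 < switchQuad y X →
      0 < (2 * y - X) * ((X - 4) * gapRoot X) - gapRoot y * ((X - 6) * y + 2 * X)) ∧
    (switchQuad y X < 0 →
      (2 * y - X) * ((X - 4) * gapRoot X) - gapRoot y * ((X - 6) * y + 2 * X) < 0) := by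
  -- Both terms are nonnegative, so they may be compared through their squares. This removes the
  -- roots, and after the factor `(X - y)²` only a quadratic in `y` is left.
  have e : ((2 * y - X) * ((X - 4) * gapRoot X)) ^ 2 - (gapRoot y * ((X - 6) * y + 2 * X)) ^ 2
      = (X - y) ^ 2 * switchQuad y X := by
    unfold switchQuad
    have a := gapRoot_sq h4.le
    have b := gapRoot_sq (h4.trans hy).le
    rw [mul_pow, mul_pow, mul_pow, a, b]; ring
  have hB : 0 < (X - 6) * y + 2 * X := by
    rcases le_total X 6 with h | h
    · nlinarith
    · nlinarith [mul_nonneg (by linarith : 0 ≤ X - 6) (by linarith : 0 ≤ y)]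
  have hA0 : 0 ≤ (2 * y - X) * ((X - 4) * gapRoot X) :=
    mul_nonneg (by linarith) (mul_nonneg (by linarith) (gapRoot_nonneg X))
  have hB0 : 0 < gapRoot y * ((X - 6) * y + 2 * X) := mul_pos (gapRoot_pos h4) hB
  have hs : 0 < (X - y) ^ 2 := by
    have : 0 < X - y := by linarith
    positivity
  constructor
  · intro h
    have := mul_pos hs h
    exact sub_pos.2 (lt_of_pow_lt_pow_left₀ 2 hA0 (by linarith))
  · intro h
    have := mul_neg_of_pos_of_neg hs h
    exact sub_neg.2 (lt_of_pow_lt_pow_left₀ 2 hB0.le (by linarith))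

/-- The function is `splitRatio` with the term `excess d` dropped, which is legitimate for `d ≤ 4`;
the numerator of the slope is the expression of `sign_switchQuad` at `y = X - d`. -/
lemma hasDerivAt_nearRatio {d X : ℝ} (h0 : 0 < d) (h4 : 4 < X - d) :
    HasDerivAt (fun d => X / 3 - X / 6 * ((excess X - excess (X - d)) / ((X - d) * d)))
      (X / 6 * (((2 * (X - d) - X) * ((X - 4) * gapRoot X) -
        gapRoot (X - d) * ((X - 6) * (X - d) + 2 * X)) / ((X - d) * d) ^ 2)) d := by
  have hs : HasDerivAt (fun d : ℝ => X - d) (-1) d := by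
    simpa using (hasDerivAt_id d).const_sub X
  have he : HasDerivAt (fun d => excess (X - d)) _ d :=
    HasDerivAt.comp d (hasDerivAt_excess h4) hs
  have hy : 0 < X - d := by linarith
  have h := (((he.const_sub (excess X)).fun_div (hs.fun_mul (hasDerivAt_id' d))
    (mul_pos hy h0).ne').const_mul (X / 6)).const_sub (X / 3)
  refine h.congr_deriv ?_
  simp only [excess]
  field_simp
  ring

lemma splitRatio_near_eqOn {D : Set ℝ} {X : ℝ}
    (hD : ∀ d ∈ D, 0 < d ∧ d ≤ 4 ∧ 4 ≤ X - d ∧ 2 * d ≤ X) :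
    Set.EqOn (fun d => X / 3 - X / 6 * ((excess X - excess (X - d)) / ((X - d) * d)))
      (fun d => splitRatio d X) D := by
  intro d hd
  obtain ⟨h0, h1, h2, h3⟩ := hD d hd
  simp only
  rw [splitRatio_eq h0 (by linarith), excess_of_le h0.le h1, sub_zero]

lemma continuousOn_nearRatio {D : Set ℝ} {X : ℝ}
    (hD : ∀ d ∈ D, 0 < d ∧ d ≤ 4 ∧ 4 ≤ X - d ∧ 2 * d ≤ X) :
    ContinuousOn (fun d => X / 3 - X / 6 * ((excess X - excess (X - d)) / ((X - d) * d))) D := by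
  have := continuous_excess
  refine ContinuousOn.sub (by fun_prop) (ContinuousOn.mul (by fun_prop)
    (ContinuousOn.div (by fun_prop) (by fun_prop) ?_))
  intro d hd
  obtain ⟨h0, h1, h2, h3⟩ := hD d hd
  exact (mul_pos (by linarith) h0).ne'

lemma interior_near {D : Set ℝ} {X : ℝ}
    (hD : ∀ d ∈ D, 0 < d ∧ d ≤ 4 ∧ 4 ≤ X - d ∧ 2 * d ≤ X) {d : ℝ} (hd : d ∈ interior D) :
    4 < X - d := by
  have : D ⊆ Set.Iic (X - 4) := fun x hx => by
    have := hD x hx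
    simp only [Set.mem_Iic]; linarith
  have := interior_mono this hd
  rw [interior_Iic] at this
  have : d < X - 4 := this
  linarith

lemma strictMonoOn_splitRatio_near {D : Set ℝ} (hc : Convex ℝ D) {X : ℝ}
    (hD : ∀ d ∈ D, 0 < d ∧ d ≤ 4 ∧ 4 ≤ X - d ∧ 2 * d ≤ X)
    (hq : ∀ d ∈ interior D, 0 < switchQuad (X - d) X) :
    StrictMonoOn (fun d => splitRatio d X) D := by
  refine StrictMonoOn.congr ?_ (splitRatio_near_eqOn hD)
  apply strictMonoOn_of_deriv_pos hc (continuousOn_nearRatio hD)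
  intro d hd
  obtain ⟨h0, h1, h2, h3⟩ := hD d (interior_subset hd)
  have h4 := interior_near hD hd
  rw [(hasDerivAt_nearRatio h0 h4).deriv]
  have := (sign_switchQuad h4 (by linarith : X - d < X) (by linarith)).1 (hq d hd)
  have hy : 0 < X - d := by linarith
  have hX : 0 < X := by linarith
  positivity

lemma strictAntiOn_splitRatio_near {D : Set ℝ} (hc : Convex ℝ D) {X : ℝ}
    (hD : ∀ d ∈ D, 0 < d ∧ d ≤ 4 ∧ 4 ≤ X - d ∧ 2 * d ≤ X)
    (hq : ∀ d ∈ interior D, switchQuad (X - d) X < 0) :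
    StrictAntiOn (fun d => splitRatio d X) D := by
  refine StrictAntiOn.congr ?_ (splitRatio_near_eqOn hD)
  apply strictAntiOn_of_deriv_neg hc (continuousOn_nearRatio hD)
  intro d hd
  obtain ⟨h0, h1, h2, h3⟩ := hD d (interior_subset hd)
  have h4 := interior_near hD hd
  rw [(hasDerivAt_nearRatio h0 h4).deriv]
  have := (sign_switchQuad h4 (by linarith : X - d < X) (by linarith)).2 (hq d hd)
  have hy : 0 < X - d := by linarith
  have hX : 0 < X := by linarith
  exact mul_neg_of_pos_of_neg (by positivity) (div_neg_of_neg_of_pos this (by positivity))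

/-- Close to the midpoint of an interval no longer than `8`, the ratio is strictly increasing. -/
lemma strictMonoOn_splitRatio_central {X : ℝ} (h4 : 4 < X) :
    StrictMonoOn (fun d => splitRatio d X) (Set.Icc (X - 4) (X / 2)) := by
  intro a ha b hb hab
  have ha1 := ha.1
  have hb2 := hb.2
  -- Neither part exceeds 4, so only `excess X` survives; it is divided by `(X - d) * d`, which
  -- grows towards the midpoint.
  have e : ∀ d ∈ Set.Icc (X - 4) (X / 2),
      splitRatio d X = X / 3 - X / 6 * (excess X / ((X - d) * d)) := by
    intro d hd
    have := hd.1
    have := hd.2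
    rw [splitRatio_eq (by linarith) (by linarith), excess_of_le (t := d) (by linarith)
      (by linarith), excess_of_le (t := X - d) (by linarith) (by linarith), sub_zero, sub_zero]
  simp only
  rw [e a ha, e b hb]
  have hX := excess_pos h4
  have h1 : 0 < (X - a) * a := mul_pos (by linarith) (by linarith)
  have h2 : (X - a) * a < (X - b) * b := by nlinarith
  have h3 := div_lt_div_of_pos_left hX h1 h2
  have := mul_lt_mul_of_pos_left h3 (by linarith : 0 < X / 6)
  linarith

/-- This is the boundary `d = 0`. The larger root of the last factor is `4 + √6`, hence the
threshold between complements throughout and initial substitutes. -/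
lemma switchQuad_self (X : ℝ) :
    switchQuad X X = -2 * X * (X - 4) * (X ^ 2 - 8 * X + 10) := by
  unfold switchQuad; ring

/-- At `y = 4` the farther part stops exceeding 4. Positivity here, for `4 < X < 8`, places the
switch from decreasing to increasing before the central region. -/
lemma switchQuad_four (X : ℝ) : switchQuad 4 X = (8 - X) ^ 2 * (X - 4) * X := by
  unfold switchQuad; ring

lemma add_sqrt_six_lt_iff {X : ℝ} (h4 : 4 < X) :
    4 + Real.sqrt 6 < X ↔ 0 < X ^ 2 - 8 * X + 10 := by
  have h6 := Real.sq_sqrt (show (0 : ℝ) ≤ 6 by norm_num)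
  have h0 := Real.sqrt_nonneg 6
  constructor
  · intro h; nlinarith
  · intro h
    by_contra hc
    nlinarith

/-- Concavity in `y`: the switch quadratic is positive on `(0, X)` when it is nonnegative at `X`. -/
lemma switchQuad_pos {y X : ℝ} (h4 : 4 < X) (hX : X ≤ 4 + Real.sqrt 6) (h0 : 0 < y)
    (hy : y < X) : 0 < switchQuad y X := by
  have h1 : X ^ 2 - 8 * X + 10 ≤ 0 := by
    by_contra h
    exact absurd ((add_sqrt_six_lt_iff h4).2 (not_le.1 h)) (not_lt.2 hX)
  have h2 : 0 ≤ switchQuad X X := by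
    rw [switchQuad_self]
    have : 0 ≤ 2 * X * (X - 4) * (-(X ^ 2 - 8 * X + 10)) :=
      mul_nonneg (mul_nonneg (by linarith) (by linarith)) (by linarith)
    linarith
  have h3 : 0 < X * (X - 4) ^ 3 := mul_pos (by linarith) (pow_pos (by linarith) 3)
  -- The chord through the values at `y = 0` and `y = X`, plus the surplus due to concavity.
  have e : X * switchQuad y X = (X - y) * (X * (X - 4) ^ 3) + y * switchQuad X X +
      X * ((X - 6) ^ 2 * (y * (X - y))) := by
    unfold switchQuad; ring
  have : 0 < X * switchQuad y X := by
    rw [e]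
    have a := mul_pos (by linarith : 0 < X - y) h3
    have b := mul_nonneg h0.le h2
    have c : 0 ≤ X * ((X - 6) ^ 2 * (y * (X - y))) :=
      mul_nonneg (by linarith) (mul_nonneg (sq_nonneg _) (mul_nonneg h0.le (by linarith)))
    linarith
  exact pos_of_mul_pos_right this (by linarith)

lemma sqrt_six_lt : Real.sqrt 6 < 3 := by
  rw [Real.sqrt_lt' (by norm_num)]; norm_num

lemma two_lt_sqrt_six : 2.4 < Real.sqrt 6 := by
  rw [Real.lt_sqrt (by norm_num)]; norm_num

lemma strictMonoOn_splitRatio {X : ℝ} (h4 : 4 < X) (hX : X ≤ 4 + Real.sqrt 6) :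
    StrictMonoOn (fun d => splitRatio d X) (Set.Ioc 0 (X / 2)) := by
  have h6 := sqrt_six_lt
  have a : StrictMonoOn (fun d => splitRatio d X) (Set.Ioc 0 (X - 4)) := by
    refine strictMonoOn_splitRatio_near (convex_Ioc _ _) ?_ ?_
    · intro d hd
      have := hd.1
      have := hd.2
      refine ⟨hd.1, ?_, ?_, ?_⟩ <;> linarith
    · intro d hd
      have := (interior_subset hd).1
      have := (interior_subset hd).2
      exact switchQuad_pos h4 hX (by linarith) (by linarith)
  have b := a.union (strictMonoOn_splitRatio_central h4) (c := X - 4)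
    ⟨⟨by linarith, le_rfl⟩, fun x hx => hx.2⟩ ⟨⟨le_rfl, by linarith⟩, fun x hx => hx.1⟩
  rwa [Set.Ioc_union_Icc_eq_Ioc (by linarith) (by linarith)] at b

/-- Factorization of the switch quadratic with the root `X - dHat 1 X`. -/
lemma switchQuad_factor {X : ℝ} (h6 : 6 < X) (hX : 0 < X ^ 2 - 8 * X + 10) (d : ℝ) :
    switchQuad (X - d) X = (X - 6) * (d - dHat 1 X) *
      (2 * (X - 2) * Real.sqrt ((18 - 8 * X + X ^ 2) / 2) + (X - 6) * (X - d) +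
        (X ^ 2 - 6 * X + 12)) := by
  have hs := Real.sq_sqrt (show 0 ≤ (18 - 8 * X + X ^ 2) / 2 by linarith)
  set s := Real.sqrt ((18 - 8 * X + X ^ 2) / 2) with hsdef
  have e : (X - 6) * dHat 1 X = 2 * ((X ^ 2 - 6 * X + 6) - (X - 2) * s) := by
    have : X - 6 ≠ 0 := by linarith
    unfold dHat
    simp only [mul_one, one_pow, ← hsdef]
    field_simp
  have e2 : (X - 6) * (d - dHat 1 X) = (X - 6) * d - 2 * ((X ^ 2 - 6 * X + 6) - (X - 2) * s) := by
    rw [← e]; ring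
  rw [e2]
  unfold switchQuad
  linear_combination (-4 * (X - 2) ^ 2) * hs

lemma dHat_spec {X : ℝ} (hX : 4 + Real.sqrt 6 < X) (h8 : X < 8) :
    0 < dHat 1 X ∧ dHat 1 X < X - 4 ∧
    (∀ d, 0 < d → d < X → d < dHat 1 X → switchQuad (X - d) X < 0) ∧
    (∀ d, 0 < d → d < X → dHat 1 X < d → 0 < switchQuad (X - d) X) := by
  have h2 := two_lt_sqrt_six
  have h4 : 4 < X := by linarith
  have h6 : 6 < X := by linarith
  have hq := (add_sqrt_six_lt_iff h4).1 hX
  have key := switchQuad_factor h6 hq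
  -- The cofactor of `d - dHat 1 X` has no zero below `X`, so the sign of `d - dHat 1 X` decides.
  have hp : ∀ d, d < X → 0 < 2 * (X - 2) * Real.sqrt ((18 - 8 * X + X ^ 2) / 2) +
      (X - 6) * (X - d) + (X ^ 2 - 6 * X + 12) := by
    intro d hd
    have a : 0 ≤ 2 * (X - 2) * Real.sqrt ((18 - 8 * X + X ^ 2) / 2) :=
      mul_nonneg (by linarith) (Real.sqrt_nonneg _)
    have b : 0 ≤ (X - 6) * (X - d) := mul_nonneg (by linarith) (by linarith)
    nlinarith
  have h60 : 0 < X - 6 := by linarith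
  -- The root is located by the signs of the quadratic at `d = 0` (negative) and at `d = X - 4`
  -- (positive).
  refine ⟨?_, ?_, ?_, ?_⟩
  · by_contra hc
    have := key 0
    rw [sub_zero, switchQuad_self] at this
    have a : 0 ≤ (X - 6) * (0 - dHat 1 X) := mul_nonneg h60.le (by linarith)
    have b := mul_nonneg a (hp 0 (by linarith)).le
    have c : 0 < 2 * X * (X - 4) * (X ^ 2 - 8 * X + 10) :=
      mul_pos (mul_pos (by linarith) (by linarith)) hq
    simp only [sub_zero] at b
    linarith
  · by_contra hc
    have := key (X - 4)
    rw [sub_sub_cancel, switchQuad_four] at this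
    have a : 0 ≤ (X - 6) * (dHat 1 X - (X - 4)) := mul_nonneg h60.le (by linarith)
    have b := mul_nonneg a (hp (X - 4) (by linarith)).le
    rw [sub_sub_cancel] at b
    have c : 0 < (8 - X) ^ 2 * (X - 4) * X :=
      mul_pos (mul_pos (pow_pos (by linarith) 2) (by linarith)) (by linarith)
    nlinarith
  · intro d h0 h1 hd
    rw [key d]
    exact mul_neg_of_neg_of_pos (mul_neg_of_pos_of_neg h60 (by linarith)) (hp d h1)
  · intro d h0 h1 hd
    rw [key d]
    exact mul_pos (mul_pos h60 (by linarith)) (hp d h1)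

lemma strictAntiOn_splitRatio_dHat {X : ℝ} (hX : 4 + Real.sqrt 6 < X) (h8 : X < 8) :
    StrictAntiOn (fun d => splitRatio d X) (Set.Ioc 0 (dHat 1 X)) := by
  obtain ⟨h0, h1, h2, h3⟩ := dHat_spec hX h8
  refine strictAntiOn_splitRatio_near (convex_Ioc _ _) ?_ ?_
  · intro d hd
    have := hd.1
    have := hd.2
    refine ⟨hd.1, ?_, ?_, ?_⟩ <;> linarith
  · intro d hd
    rw [interior_Ioc] at hd
    exact h2 d hd.1 (by linarith [hd.2]) hd.2

lemma strictMonoOn_splitRatio_dHat {X : ℝ} (hX : 4 + Real.sqrt 6 < X) (h8 : X < 8) :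
    StrictMonoOn (fun d => splitRatio d X) (Set.Icc (dHat 1 X) (X / 2)) := by
  obtain ⟨h0, h1, h2, h3⟩ := dHat_spec hX h8
  have hs := two_lt_sqrt_six
  have a : StrictMonoOn (fun d => splitRatio d X) (Set.Icc (dHat 1 X) (X - 4)) := by
    refine strictMonoOn_splitRatio_near (convex_Icc _ _) ?_ ?_
    · intro d hd
      have := hd.1
      have := hd.2
      refine ⟨?_, ?_, ?_, ?_⟩ <;> linarith
    · intro d hd
      rw [interior_Icc] at hd
      exact h3 d (h0.trans hd.1) (by linarith [hd.2]) hd.1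
  have b := a.union (strictMonoOn_splitRatio_central (by linarith)) (c := X - 4)
    ⟨⟨h1.le, le_rfl⟩, fun x hx => hx.2⟩ ⟨⟨le_rfl, by linarith⟩, fun x hx => hx.1⟩
  rwa [Set.Icc_union_Icc_eq_Icc h1.le (by linarith)] at b

/-- For nonnegative reals, `√b + √c < √a` follows from these two inequalities by squaring twice. In
the variables `u = d - 4`, `v = y - d` both expressions expand with positive coefficients only. -/
lemma slope_polynomial {u v : ℝ} (hu : 0 ≤ u) (hv : 0 < v) {a b c : ℝ}
    (ha : a = (4 + u + v) * (u + v) * ((2 + 2 * u + v) * (4 + u + v) + 2 * (8 + 2 * u + v)) ^ 2)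
    (hb : b = (4 + u) * u * ((2 + 2 * u + v) * (4 + u) + 2 * (8 + 2 * u + v)) ^ 2)
    (hc : c = v ^ 2 * (4 + 2 * u + v) ^ 2 * ((8 + 2 * u + v) * (4 + 2 * u + v))) :
    0 < a - b - c ∧ 0 < (a - b - c) ^ 2 - 4 * (b * c) := by
  subst ha hb hc
  constructor
  · ring_nf; positivity
  · ring_nf; positivity

/-- The slope inequality behind substitutability when both parts are longer than `4`. -/
lemma gapRoot_slope_lt {d y : ℝ} (hd : 4 ≤ d) (hy : d < y) :
    (y - d) * ((d + y - 4) * gapRoot (d + y)) + gapRoot d * ((d + y - 6) * d + 2 * (d + y)) <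
      gapRoot y * ((d + y - 6) * y + 2 * (d + y)) := by
  have ha := gapRoot_sq (by linarith : 4 ≤ y)
  have hb := gapRoot_sq hd
  have hc := gapRoot_sq (by linarith : 4 ≤ d + y)
  have hap : 0 ≤ gapRoot y * ((d + y - 6) * y + 2 * (d + y)) :=
    mul_nonneg (gapRoot_nonneg y) (by nlinarith)
  have hbp : 0 ≤ gapRoot d * ((d + y - 6) * d + 2 * (d + y)) :=
    mul_nonneg (gapRoot_nonneg d) (by nlinarith)
  have hcp : 0 ≤ (y - d) * ((d + y - 4) * gapRoot (d + y)) :=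
    mul_nonneg (by linarith) (mul_nonneg (by linarith) (gapRoot_nonneg _))
  have a2 : (gapRoot y * ((d + y - 6) * y + 2 * (d + y))) ^ 2 =
      y * (y - 4) * ((d + y - 6) * y + 2 * (d + y)) ^ 2 := by rw [mul_pow, ha]
  have b2 : (gapRoot d * ((d + y - 6) * d + 2 * (d + y))) ^ 2 =
      d * (d - 4) * ((d + y - 6) * d + 2 * (d + y)) ^ 2 := by rw [mul_pow, hb]
  have c2 : ((y - d) * ((d + y - 4) * gapRoot (d + y))) ^ 2 =
      (y - d) ^ 2 * (d + y - 4) ^ 2 * ((d + y) * (d + y - 4)) := by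
    rw [mul_pow, mul_pow, hc]; ring
  generalize gapRoot y * ((d + y - 6) * y + 2 * (d + y)) = a at *
  generalize gapRoot d * ((d + y - 6) * d + 2 * (d + y)) = b at *
  generalize (y - d) * ((d + y - 4) * gapRoot (d + y)) = c at *
  obtain ⟨h1, h2⟩ := slope_polynomial (u := d - 4) (v := y - d) (a := a ^ 2) (b := b ^ 2)
    (c := c ^ 2) (by linarith) (by linarith) (by rw [a2]; ring) (by rw [b2]; ring)
    (by rw [c2]; ring)
  have h3 : (2 * (b * c)) ^ 2 < (a ^ 2 - b ^ 2 - c ^ 2) ^ 2 := by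
    linarith [show (2 * (b * c)) ^ 2 = 4 * (b ^ 2 * c ^ 2) by ring]
  have h4 := lt_of_pow_lt_pow_left₀ 2 h1.le h3
  exact lt_of_pow_lt_pow_left₀ 2 hap (by
    linarith [show (c + b) ^ 2 = c ^ 2 + b ^ 2 + 2 * (b * c) by ring])

lemma strictAntiOn_splitRatio_far {X : ℝ} (h8 : 8 < X) :
    StrictAntiOn (fun d => splitRatio d X) (Set.Icc 4 (X / 2)) := by
  have heq : Set.EqOn
      (fun d => X / 3 - X / 6 * ((excess X - excess d - excess (X - d)) / ((X - d) * d)))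
      (fun d => splitRatio d X) (Set.Icc 4 (X / 2)) := fun d hd => by
    have := hd.1
    have := hd.2
    exact (splitRatio_eq (by linarith) (by linarith)).symm
  refine StrictAntiOn.congr ?_ heq
  apply strictAntiOn_of_deriv_neg (convex_Icc _ _)
  · have := continuous_excess
    refine ContinuousOn.sub (by fun_prop) (ContinuousOn.mul (by fun_prop)
      (ContinuousOn.div (by fun_prop) (by fun_prop) ?_))
    intro d hd
    have := hd.1
    have := hd.2
    exact (mul_pos (by linarith) (by linarith)).ne'
  · intro d hd
    rw [interior_Icc] at hd
    have h4 := hd.1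
    have h2 := hd.2
    have hs : HasDerivAt (fun d : ℝ => X - d) (-1) d := by
      simpa using (hasDerivAt_id d).const_sub X
    have he : HasDerivAt (fun d => excess (X - d)) _ d :=
      HasDerivAt.comp d (hasDerivAt_excess (by linarith : 4 < X - d)) hs
    have hy : 0 < X - d := by linarith
    have h0 : 0 < d := by linarith
    have h := (((((hasDerivAt_excess h4).const_sub (excess X)).fun_sub he).fun_div
      (hs.fun_mul (hasDerivAt_id' d)) (mul_pos hy h0).ne').const_mul (X / 6)).const_sub (X / 3)
    have key := gapRoot_slope_lt h4.le (by linarith : d < X - d)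
    rw [add_sub_cancel] at key
    have e : X / 6 * ((((X - d - d) * ((X - 4) * gapRoot X) +
        gapRoot d * ((X - 6) * d + 2 * X)) - gapRoot (X - d) * ((X - 6) * (X - d) + 2 * X)) /
          ((X - d) * d) ^ 2) < 0 :=
      mul_neg_of_pos_of_neg (by linarith)
        (div_neg_of_neg_of_pos (by linarith) (by positivity))
    refine lt_of_eq_of_lt ?_ e
    refine h.deriv.trans ?_
    simp only [excess]
    field_simp
    ring

lemma strictAntiOn_splitRatio {X : ℝ} (h8 : 8 < X) :
    StrictAntiOn (fun d => splitRatio d X) (Set.Ioc 0 (X / 2)) := by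
  have a : StrictAntiOn (fun d => splitRatio d X) (Set.Ioc 0 4) := by
    refine strictAntiOn_splitRatio_near (convex_Ioc _ _) ?_ ?_
    · intro d hd
      have := hd.1
      have := hd.2
      refine ⟨hd.1, ?_, ?_, ?_⟩ <;> linarith
    · intro d hd
      rw [interior_Ioc] at hd
      have h1 := hd.1
      have h2 := hd.2
      -- Concavity again: `X / 2` lies between `0`, where the quadratic is positive, and `X - d`.
      -- Since it is negative at `X / 2`, it must be negative at `X - d`.
      have e : (X - d) * switchQuad (X / 2) X = (X / 2 - d) * (X * (X - 4) ^ 3) +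
          X / 2 * switchQuad (X - d) X +
            (X - 6) ^ 2 * ((X / 2) * ((X / 2 - d) * (X - d))) := by
        unfold switchQuad; ring
      have hm : switchQuad (X / 2) X < 0 := by
        have : switchQuad (X / 2) X = X * (8 - X * (X - 6) ^ 2 / 4) := by
          unfold switchQuad; ring
        rw [this]
        exact mul_neg_of_pos_of_neg (by linarith) (by nlinarith)
      by_contra hc
      have h3 : 0 ≤ X / 2 * switchQuad (X - d) X := mul_nonneg (by linarith) (not_lt.1 hc)
      have h4 : 0 < (X / 2 - d) * (X * (X - 4) ^ 3) :=
        mul_pos (by linarith) (mul_pos (by linarith) (pow_pos (by linarith) 3))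
      have h5 : 0 ≤ (X - 6) ^ 2 * ((X / 2) * ((X / 2 - d) * (X - d))) :=
        mul_nonneg (sq_nonneg _) (mul_nonneg (by linarith)
          (mul_nonneg (by linarith) (by linarith)))
      have h6 := mul_neg_of_pos_of_neg (by linarith : 0 < X - d) hm
      linarith
  have b := a.union (strictAntiOn_splitRatio_far h8) (c := 4)
    ⟨⟨by linarith, le_rfl⟩, fun x hx => hx.2⟩ ⟨⟨le_rfl, by linarith⟩, fun x hx => hx.1⟩
  rwa [Set.Ioc_union_Icc_eq_Ioc (by norm_num) (by linarith)] at b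

end ResearchModel

/-! ### The error function. -/

namespace ResearchModel

open Filter Topology

lemma two_div_sqrt_pi_pos : 0 < 2 / Real.sqrt Real.pi := by
  have := Real.sqrt_pos.2 Real.pi_pos
  positivity

lemma hasDerivAt_erf (z : ℝ) : HasDerivAt erf (2 / Real.sqrt Real.pi * Real.exp (-z ^ 2)) z := by
  have hc : Continuous fun t : ℝ => Real.exp (-t ^ 2) := by fun_prop
  exact (intervalIntegral.integral_hasDerivAt_right (hc.intervalIntegrable _ _)
    (hc.stronglyMeasurableAtFilter _ _) hc.continuousAt).const_mul _

lemma continuous_erf : Continuous erf :=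
  continuous_iff_continuousAt.2 fun z => (hasDerivAt_erf z).continuousAt

lemma strictMono_erf : StrictMono erf := by
  apply strictMono_of_deriv_pos
  intro z
  rw [(hasDerivAt_erf z).deriv]
  exact mul_pos two_div_sqrt_pi_pos (Real.exp_pos _)

lemma erf_zero : erf 0 = 0 := by simp [erf]

lemma erf_nonneg {z : ℝ} (hz : 0 ≤ z) : 0 ≤ erf z := by
  rw [← erf_zero]; exact strictMono_erf.monotone hz

lemma erf_pos {z : ℝ} (hz : 0 < z) : 0 < erf z := by
  rw [← erf_zero]; exact strictMono_erf hz

lemma tendsto_erf : Tendsto erf atTop (𝓝 1) := by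
  have hi : MeasureTheory.Integrable fun t : ℝ => Real.exp (-t ^ 2) := by
    simpa using integrable_exp_neg_mul_sq (b := 1) one_pos
  have h := MeasureTheory.intervalIntegral_tendsto_integral_Ioi (0 : ℝ) hi.integrableOn tendsto_id
  have hg : ∫ t in Set.Ioi (0 : ℝ), Real.exp (-t ^ 2) = Real.sqrt Real.pi / 2 := by
    simpa using integral_gaussian_Ioi 1
  rw [hg] at h
  have h2 := h.const_mul (2 / Real.sqrt Real.pi)
  have h3 := Real.sqrt_pos.2 Real.pi_pos
  rwa [show 2 / Real.sqrt Real.pi * (Real.sqrt Real.pi / 2) = 1 by field_simp] at h2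

lemma erf_lt_one (z : ℝ) : erf z < 1 :=
  (strictMono_erf (lt_add_one z)).trans_le
    (strictMono_erf.monotone.ge_of_tendsto tendsto_erf (z + 1))

lemma exists_erf_eq {ρ : ℝ} (h0 : 0 ≤ ρ) (h1 : ρ < 1) : ∃ z, 0 ≤ z ∧ erf z = ρ := by
  obtain ⟨b, hb⟩ := (tendsto_erf.eventually (lt_mem_nhds h1)).exists
  have hb0 : 0 < b := by
    rw [← strictMono_erf.lt_iff_lt, erf_zero]; linarith
  obtain ⟨z, hz, h⟩ := intermediate_value_Icc hb0.le continuous_erf.continuousOn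
    (show ρ ∈ Set.Icc (erf 0) (erf b) from ⟨by rwa [erf_zero], hb.le⟩)
  exact ⟨z, hz.1, h⟩

lemma erfInv_erf (z : ℝ) : erfInv (erf z) = z :=
  Function.leftInverse_invFun strictMono_erf.injective z

/-- A lower bound for `erf`: it exceeds `z` times the value of its integrand at `z`. -/
lemma lt_erf {z : ℝ} (hz : 0 < z) :
    2 * z < Real.sqrt Real.pi * Real.exp (z ^ 2) * erf z := by
  have key : StrictMonoOn (fun z : ℝ => erf z - 2 / Real.sqrt Real.pi * (z * Real.exp (-z ^ 2)))
      (Set.Ici 0) := by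
    have hd : ∀ z : ℝ, HasDerivAt
        (fun z : ℝ => erf z - 2 / Real.sqrt Real.pi * (z * Real.exp (-z ^ 2)))
        (2 / Real.sqrt Real.pi * (2 * z ^ 2 * Real.exp (-z ^ 2))) z := by
      intro z
      have h1 : HasDerivAt (fun z : ℝ => Real.exp (-z ^ 2)) _ z :=
        ((hasDerivAt_pow 2 z).fun_neg).exp
      have h := (hasDerivAt_erf z).fun_sub
        (((hasDerivAt_id' z).fun_mul h1).const_mul (2 / Real.sqrt Real.pi))
      refine h.congr_deriv ?_
      push_cast
      ring
    apply strictMonoOn_of_deriv_pos (convex_Ici 0)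
    · exact (continuous_iff_continuousAt.2 fun z => (hd z).continuousAt).continuousOn
    · intro z hz
      rw [interior_Ici] at hz
      have hz0 : (0 : ℝ) < z := hz
      rw [(hd z).deriv]
      have := two_div_sqrt_pi_pos
      positivity
  have h := key (Set.mem_Ici.2 le_rfl) (Set.mem_Ici.2 hz.le) hz
  simp only [erf_zero, zero_mul, mul_zero, sub_zero] at h
  have h3 := Real.sqrt_pos.2 Real.pi_pos
  have h4 := mul_pos h3 (Real.exp_pos (z ^ 2))
  have h5 := mul_pos h4 h
  have e : Real.sqrt Real.pi * Real.exp (z ^ 2) *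
      (2 / Real.sqrt Real.pi * (z * Real.exp (-z ^ 2))) = 2 * z := by
    rw [Real.exp_neg]
    have := Real.exp_pos (z ^ 2)
    field_simp
  rw [mul_sub, e] at h5
  linarith

/-! ### Optimal output and optimal value as functions of the ratio. -/

/-- The ratio of benefit to variance at which output `erf z` is optimal. -/
noncomputable def focRatio (η z : ℝ) : ℝ := Real.sqrt Real.pi * η * (z * Real.exp (z ^ 2))

/-- The optimal value of `z = erfInv ρ` given the ratio of benefit to variance. -/
noncomputable def optArg (η : ℝ) : ℝ → ℝ := Function.invFun (focRatio η)

/-- The optimal payoff per unit of variance given the ratio of benefit to variance. -/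
noncomputable def optValue (η R : ℝ) : ℝ := erf (optArg η R) * R - η * optArg η R ^ 2

lemma hasDerivAt_focRatio (η z : ℝ) :
    HasDerivAt (focRatio η) (Real.sqrt Real.pi * η * (Real.exp (z ^ 2) * (1 + 2 * z ^ 2))) z := by
  have h1 : HasDerivAt (fun z : ℝ => Real.exp (z ^ 2)) _ z := (hasDerivAt_pow 2 z).exp
  have h := ((hasDerivAt_id' z).fun_mul h1).const_mul (Real.sqrt Real.pi * η)
  refine h.congr_deriv ?_
  push_cast
  ring

/-- The first-order condition: marginal probability times ratio equals marginal cost. -/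
lemma density_mul_focRatio (η z : ℝ) :
    2 / Real.sqrt Real.pi * Real.exp (-z ^ 2) * focRatio η z = 2 * η * z := by
  have := Real.sqrt_pos.2 Real.pi_pos
  have := Real.exp_pos (z ^ 2)
  unfold focRatio
  rw [Real.exp_neg]
  field_simp

lemma hasDerivAt_output (η R z : ℝ) : HasDerivAt (fun z => erf z * R - η * z ^ 2)
    (2 / Real.sqrt Real.pi * Real.exp (-z ^ 2) * (R - focRatio η z)) z := by
  have h := ((hasDerivAt_erf z).mul_const R).fun_sub ((hasDerivAt_pow 2 z).const_mul η)
  refine h.congr_deriv ?_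
  rw [mul_sub, density_mul_focRatio]
  push_cast
  ring

section
variable {η : ℝ} (hη : 0 < η)
include hη

lemma sqrt_pi_mul_pos : 0 < Real.sqrt Real.pi * η :=
  mul_pos (Real.sqrt_pos.2 Real.pi_pos) hη

lemma deriv_focRatio_pos (z : ℝ) :
    0 < Real.sqrt Real.pi * η * (Real.exp (z ^ 2) * (1 + 2 * z ^ 2)) := by
  have := sqrt_pi_mul_pos hη
  have := Real.exp_pos (z ^ 2)
  positivity

lemma strictMono_focRatio : StrictMono (focRatio η) := by
  apply strictMono_of_deriv_pos
  intro z
  rw [(hasDerivAt_focRatio η z).deriv]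
  exact deriv_focRatio_pos hη z

/-- With strict monotonicity on the whole line, this makes `optArg` a two-sided inverse without any
range condition. -/
lemma surjective_focRatio : Function.Surjective (focRatio η) := by
  have hc := sqrt_pi_mul_pos hη
  have hexp : ∀ z : ℝ, 1 ≤ Real.exp (z ^ 2) := fun z => Real.one_le_exp (sq_nonneg z)
  apply Continuous.surjective
  · exact continuous_iff_continuousAt.2 fun z => (hasDerivAt_focRatio η z).continuousAt
  · refine tendsto_atTop_mono' _ ?_ (tendsto_id.const_mul_atTop hc)
    filter_upwards [eventually_ge_atTop 0] with z hz
    exact mul_le_mul_of_nonneg_left (le_mul_of_one_le_right hz (hexp z)) hc.le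
  · refine tendsto_atBot_mono' _ ?_ (tendsto_id.const_mul_atBot hc)
    filter_upwards [eventually_le_atBot 0] with z hz
    exact mul_le_mul_of_nonneg_left (by simp only [id]; nlinarith [hexp z]) hc.le

lemma focRatio_optArg (R : ℝ) : focRatio η (optArg η R) = R :=
  Function.rightInverse_invFun (surjective_focRatio hη) R

lemma optArg_focRatio (z : ℝ) : optArg η (focRatio η z) = z :=
  Function.leftInverse_invFun (strictMono_focRatio hη).injective z

lemma strictMono_optArg : StrictMono (optArg η) := by
  intro a b hab
  rwa [← (strictMono_focRatio hη).lt_iff_lt, focRatio_optArg hη, focRatio_optArg hη]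

lemma optArg_zero : optArg η 0 = 0 := by
  have := optArg_focRatio hη 0
  rwa [show focRatio η 0 = 0 by simp [focRatio]] at this

lemma optArg_pos {R : ℝ} (hR : 0 < R) : 0 < optArg η R := by
  rw [← optArg_zero hη]; exact strictMono_optArg hη hR

lemma optArg_nonneg {R : ℝ} (hR : 0 ≤ R) : 0 ≤ optArg η R := by
  rw [← optArg_zero hη]; exact (strictMono_optArg hη).monotone hR

lemma continuous_optArg : Continuous (optArg η) :=
  (strictMono_optArg hη).monotone.continuous_of_surjective
    fun z => ⟨focRatio η z, optArg_focRatio hη z⟩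

/-- The optimal output is unique. -/
lemma output_lt_optValue {R z : ℝ} (hz : z ≠ optArg η R) :
    erf z * R - η * z ^ 2 < optValue η R := by
  have hd := hasDerivAt_output η R
  have hcont : Continuous fun z => erf z * R - η * z ^ 2 :=
    continuous_iff_continuousAt.2 fun z => (hd z).continuousAt
  have hpos : ∀ z : ℝ, 0 < 2 / Real.sqrt Real.pi * Real.exp (-z ^ 2) := fun z =>
    mul_pos two_div_sqrt_pi_pos (Real.exp_pos _)
  rcases lt_or_gt_of_ne hz with h | h
  · have := strictMonoOn_of_deriv_pos (convex_Iic (optArg η R)) hcont.continuousOn (fun x hx => by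
      rw [interior_Iic] at hx
      have := strictMono_focRatio hη hx
      rw [focRatio_optArg hη] at this
      rw [(hd x).deriv]
      exact mul_pos (hpos x) (sub_pos.2 this))
    exact this (Set.mem_Iic.2 h.le) (Set.mem_Iic.2 le_rfl) h
  · have := strictAntiOn_of_deriv_neg (convex_Ici (optArg η R)) hcont.continuousOn (fun x hx => by
      rw [interior_Ici] at hx
      have := strictMono_focRatio hη hx
      rw [focRatio_optArg hη] at this
      rw [(hd x).deriv]
      exact mul_neg_of_pos_of_neg (hpos x) (sub_neg.2 this))
    exact this (Set.mem_Ici.2 le_rfl) (Set.mem_Ici.2 h.le) h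

lemma output_le_optValue (R z : ℝ) : erf z * R - η * z ^ 2 ≤ optValue η R := by
  by_cases h : z = optArg η R
  · rw [h]; rfl
  · exact (output_lt_optValue hη h).le

lemma optValue_pos {R : ℝ} (hR : 0 < R) : 0 < optValue η R := by
  have := output_lt_optValue hη (R := R) (z := 0) (optArg_pos hη hR).ne
  simpa [erf_zero] using this

lemma optValue_zero : optValue η 0 = 0 := by simp [optValue, optArg_zero hη]

lemma optValue_le {R : ℝ} (hR : 0 ≤ R) : optValue η R ≤ R := by
  have h1 := erf_lt_one (optArg η R)
  have h2 := mul_nonneg hη.le (sq_nonneg (optArg η R))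
  unfold optValue
  nlinarith

/-- The envelope theorem: by the first-order condition, the effect through `optArg` cancels. -/
lemma hasDerivAt_optValue (R : ℝ) : HasDerivAt (optValue η) (erf (optArg η R)) R := by
  have hz : HasDerivAt (optArg η) _ R :=
    HasDerivAt.of_local_left_inverse (continuous_optArg hη).continuousAt
      (hasDerivAt_focRatio η (optArg η R)) (deriv_focRatio_pos hη _).ne'
      (Eventually.of_forall (focRatio_optArg hη))
  have he := (hasDerivAt_erf (optArg η R)).comp R hz
  have h : HasDerivAt (optValue η) _ R := (he.fun_mul (hasDerivAt_id' R)).fun_sub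
    (((hz.fun_pow 2)).const_mul η)
  refine h.congr_deriv ?_
  have h5 := density_mul_focRatio η (optArg η R)
  rw [focRatio_optArg hη] at h5
  simp only [Function.comp]
  push_cast
  linear_combination (Real.sqrt Real.pi * η * (Real.exp (optArg η R ^ 2) *
    (1 + 2 * optArg η R ^ 2)))⁻¹ * h5

lemma optValue_lt_optValue {a b : ℝ} (ha : 0 ≤ a) (hab : a < b) :
    optValue η a < optValue η b := by
  have h1 := output_le_optValue hη b (optArg η b)
  have h2 := output_lt_optValue hη (R := b) (z := optArg η a) (strictMono_optArg hη hab).ne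
  have h3 := mul_nonneg (erf_nonneg (optArg_nonneg hη ha)) (sub_nonneg.2 hab.le)
  have : optValue η a = erf (optArg η a) * a - η * optArg η a ^ 2 := rfl
  nlinarith

/-- The logarithmic derivative of `optValue` is strictly decreasing. -/
lemma strictAntiOn_logDeriv_optValue :
    StrictAntiOn (fun R => erf (optArg η R) / optValue η R) (Set.Ioi 0) := by
  have hc := sqrt_pi_mul_pos hη
  have hm : ∀ z, 0 < z → 0 < erf z * focRatio η z - η * z ^ 2 := by
    intro z hz
    have h := optValue_pos hη (R := focRatio η z) (by
      have := strictMono_focRatio hη hz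
      rwa [show focRatio η 0 = 0 by simp [focRatio]] at this)
    unfold optValue at h
    rwa [optArg_focRatio hη] at h
  have hd : ∀ z, 0 < z → HasDerivAt (fun z => erf z / (erf z * focRatio η z - η * z ^ 2)) _ z :=
    fun z hz => (hasDerivAt_erf z).fun_div (((hasDerivAt_erf z).fun_mul
      (hasDerivAt_focRatio η z)).fun_sub ((hasDerivAt_pow 2 z).const_mul η)) (hm z hz).ne'
  -- In the variable `z = optArg η R`, increasing in `R`, every function involved is explicit.
  have hk : StrictAntiOn (fun z => erf z / (erf z * focRatio η z - η * z ^ 2)) (Set.Ioi 0) := by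
    apply strictAntiOn_of_deriv_neg (convex_Ioi 0)
    · exact fun z hz => (hd z hz).continuousAt.continuousWithinAt
    · intro z hz
      rw [interior_Ioi] at hz
      have hz0 : (0 : ℝ) < z := hz
      rw [(hd z hz).deriv]
      apply div_neg_of_neg_of_pos _ (pow_pos (hm z hz) 2)
      have h1 := lt_erf hz0
      have h2 := erf_pos hz0
      have h3 := Real.sqrt_pos.2 Real.pi_pos
      have h4 := Real.exp_pos (z ^ 2)
      have e1 := density_mul_focRatio η z
      have e2 : 0 < 2 / Real.sqrt Real.pi * Real.exp (-z ^ 2) :=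
        mul_pos two_div_sqrt_pi_pos (Real.exp_pos _)
      set c := 2 / Real.sqrt Real.pi * Real.exp (-z ^ 2)
      set g := focRatio η z
      set r := erf z
      have h5 : 0 < η * r * (Real.sqrt Real.pi * Real.exp (z ^ 2) * r - 2 * z) :=
        mul_pos (mul_pos hη h2) (by linarith)
      have h6 : 0 ≤ c * (η * z ^ 2) := by positivity
      have h7 : 0 ≤ Real.sqrt Real.pi * η * (Real.exp (z ^ 2) * (2 * z ^ 2)) * r ^ 2 := by
        positivity
      push_cast
      -- The numerator of the derivative splits into three nonpositive terms; the first is strictly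
      -- negative by `lt_erf`.
      have : c * (r * g - η * z ^ 2) - r * (c * g + r * (Real.sqrt Real.pi * η *
          (Real.exp (z ^ 2) * (1 + 2 * z ^ 2))) - η * (2 * z ^ (2 - 1))) =
          -(η * r * (Real.sqrt Real.pi * Real.exp (z ^ 2) * r - 2 * z)) - c * (η * z ^ 2) -
          Real.sqrt Real.pi * η * (Real.exp (z ^ 2) * (2 * z ^ 2)) * r ^ 2 := by
        norm_num
        ring
      rw [this]
      linarith
  intro a ha b hb hab
  have h := hk (Set.mem_Ioi.2 (optArg_pos hη ha)) (Set.mem_Ioi.2 (optArg_pos hη hb))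
    (strictMono_optArg hη hab)
  simp only [focRatio_optArg hη] at h
  exact h

/-- Strict log-concavity of `optValue`. -/
lemma optValue_logConcave {a b δ : ℝ} (hδ : 0 < δ) (ha : δ < a) (hab : a < b) :
    optValue η (a - δ) * optValue η b < optValue η a * optValue η (b - δ) := by
  have hd : ∀ R, δ < R → HasDerivAt (fun R => optValue η (R - δ) / optValue η R) _ R :=
    fun R hR => (HasDerivAt.comp_sub_const R δ (hasDerivAt_optValue hη (R - δ))).fun_div
      (hasDerivAt_optValue hη R) (optValue_pos hη (hδ.trans hR)).ne'
  have hk : StrictMonoOn (fun R => optValue η (R - δ) / optValue η R) (Set.Ioi δ) := by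
    apply strictMonoOn_of_deriv_pos (convex_Ioi δ)
    · exact fun R hR => (hd R hR).continuousAt.continuousWithinAt
    · intro R hR
      rw [interior_Ioi] at hR
      have hR0 : δ < R := hR
      rw [(hd R hR).deriv]
      have p1 := optValue_pos hη (hδ.trans hR0)
      have p2 := optValue_pos hη (sub_pos.2 hR0)
      apply div_pos _ (pow_pos p1 2)
      have := strictAntiOn_logDeriv_optValue hη (Set.mem_Ioi.2 (sub_pos.2 hR0))
        (Set.mem_Ioi.2 (hδ.trans hR0)) (by linarith)
      simp only at this
      rw [div_lt_div_iff₀ p1 p2] at this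
      linarith
  have h := hk (Set.mem_Ioi.2 ha) (Set.mem_Ioi.2 (ha.trans hab)) hab
  simp only at h
  rw [div_lt_div_iff₀ (optValue_pos hη (hδ.trans ha))
    (optValue_pos hη (hδ.trans (ha.trans hab)))] at h
  linarith

lemma continuous_optValue : Continuous (optValue η) :=
  continuous_iff_continuousAt.2 fun R => (hasDerivAt_optValue hη R).continuousAt

end

end ResearchModel

/-! ### The payoff of the best output. -/

namespace ResearchModel

open Filter Topology

/-- The payoff from the optimal output on a question with benefit `V` and variance `S`. -/
noncomputable def bestPayoff (η V S : ℝ) : ℝ := S * optValue η (V / S)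

/-- The payoff of the best output at distance `d` from an endpoint of an interval of length `X`. -/
noncomputable def boundedPayoff (η d X : ℝ) : ℝ := bestPayoff η (splitValue d X) (bridgeVar d X)

/-- The payoff of the best output at distance `d` beyond the frontier. -/
noncomputable def frontierPayoff (η d : ℝ) : ℝ := bestPayoff η (intervalValue d) d

section
variable {η : ℝ} (hη : 0 < η)
include hη

lemma output_le_bestPayoff {V S : ℝ} (hS : 0 ≤ S) (hV : S = 0 → V = 0) (z : ℝ) :
    erf z * V - η * (z ^ 2 * S) ≤ bestPayoff η V S := by
  rcases hS.eq_or_lt with h | h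
  · simp [bestPayoff, ← h, hV h.symm]
  · have := mul_le_mul_of_nonneg_left (output_le_optValue hη (V / S) z) hS
    unfold bestPayoff
    refine le_trans (le_of_eq ?_) this
    field_simp

lemma output_lt_bestPayoff {V S z : ℝ} (hS : 0 < S) (hz : z ≠ optArg η (V / S)) :
    erf z * V - η * (z ^ 2 * S) < bestPayoff η V S := by
  have := mul_lt_mul_of_pos_left (output_lt_optValue hη hz) hS
  unfold bestPayoff
  refine lt_of_eq_of_lt ?_ this
  field_simp

omit hη in
-- At `S = 0` both sides vanish whatever value `V / 0` gives to `optArg`, so known questions need no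
-- separate treatment.
lemma bestPayoff_eq {V S : ℝ} (hV : S = 0 → V = 0) :
    bestPayoff η V S = erf (optArg η (V / S)) * V - η * (optArg η (V / S) ^ 2 * S) := by
  by_cases h : S = 0
  · simp [bestPayoff, h, hV h]
  · unfold bestPayoff optValue
    field_simp

lemma bestPayoff_nonneg {V S : ℝ} (hS : 0 ≤ S) (hV : 0 ≤ V) : 0 ≤ bestPayoff η V S := by
  rcases (div_nonneg hV hS).eq_or_lt with h | h
  · rw [bestPayoff, ← h, optValue_zero hη, mul_zero]
  · exact mul_nonneg hS (optValue_pos hη h).le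

lemma bestPayoff_pos {V S : ℝ} (hS : 0 < S) (hV : 0 < V) : 0 < bestPayoff η V S :=
  mul_pos hS (optValue_pos hη (div_pos hV hS))

lemma bestPayoff_le {V S : ℝ} (hS : 0 ≤ S) (hV : 0 ≤ V) : bestPayoff η V S ≤ V := by
  rcases hS.eq_or_lt with h | h
  · simpa [bestPayoff, ← h] using hV
  · refine (mul_le_mul_of_nonneg_left (optValue_le hη (div_nonneg hV hS)) hS).trans (le_of_eq ?_)
    field_simp

/-- Where `S` vanishes the ratio is of no use; there the payoff is squeezed between `0` and the
benefit. -/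
lemma continuousOn_bestPayoff {V S : ℝ → ℝ} {D : Set ℝ} (hV : ContinuousOn V D)
    (hS : ContinuousOn S D) (hS0 : ∀ d ∈ D, 0 ≤ S d) (hV0 : ∀ d ∈ D, 0 ≤ V d)
    (h0 : ∀ d ∈ D, S d = 0 → V d = 0) :
    ContinuousOn (fun d => bestPayoff η (V d) (S d)) D := by
  intro d hd
  by_cases h : S d = 0
  · have hVd := h0 d hd h
    have e : bestPayoff η (V d) (S d) = 0 := by simp [bestPayoff, h]
    change Tendsto _ _ (𝓝 (bestPayoff η (V d) (S d)))
    rw [e]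
    have hlim : Tendsto V (𝓝[D] d) (𝓝 0) := by simpa [ContinuousWithinAt, hVd] using hV d hd
    refine tendsto_of_tendsto_of_tendsto_of_le_of_le' tendsto_const_nhds hlim ?_ ?_
    · filter_upwards [self_mem_nhdsWithin] with x hx
      exact bestPayoff_nonneg hη (hS0 x hx) (hV0 x hx)
    · filter_upwards [self_mem_nhdsWithin] with x hx
      exact bestPayoff_le hη (hS0 x hx) (hV0 x hx)
  · exact (hS d hd).mul ((continuous_optValue hη).continuousAt.comp_continuousWithinAt
      ((hV d hd).div (hS d hd) h))

end

lemma intervalValue_zero : intervalValue 0 = 0 := by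
  simp [intervalValue_of_le le_rfl (by norm_num : (0 : ℝ) ≤ 4)]

lemma intervalValue_nonneg {t : ℝ} (h0 : 0 ≤ t) : 0 ≤ intervalValue t := by
  rcases h0.eq_or_lt with h | h
  · rw [← h, intervalValue_zero]
  · exact (intervalValue_pos h).le

lemma splitValue_symm (d X : ℝ) : splitValue (X - d) X = splitValue d X := by
  unfold splitValue; rw [sub_sub_cancel]; ring

lemma bridgeVar_symm (d X : ℝ) : bridgeVar (X - d) X = bridgeVar d X := by
  unfold bridgeVar; rw [sub_sub_cancel]; ring

lemma boundedPayoff_symm (η d X : ℝ) : boundedPayoff η (X - d) X = boundedPayoff η d X := by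
  unfold boundedPayoff; rw [splitValue_symm, bridgeVar_symm]

lemma splitValue_zero (X : ℝ) : splitValue 0 X = 0 := by
  simp [splitValue, intervalValue_zero]

lemma bridgeVar_zero (X : ℝ) : bridgeVar 0 X = 0 := by simp [bridgeVar]

/-! ### The optimal distance beyond the frontier. -/

section frontier
variable {η : ℝ} (hη : 0 < η)
include hη

omit hη in
lemma frontierPayoff_zero : frontierPayoff η 0 = 0 := by simp [frontierPayoff, bestPayoff]

lemma frontierPayoff_pos {d : ℝ} (hd : 0 < d) : 0 < frontierPayoff η d :=
  bestPayoff_pos hη hd (intervalValue_pos hd)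

/-- The benefit peaks at 3, so moving back to 3 with the same output loses no benefit and lowers the
variance. -/
lemma frontierPayoff_lt {d : ℝ} (hd : 3 < d) : frontierPayoff η d < frontierPayoff η 3 := by
  have hd0 : 0 < d := by linarith
  have hz := optArg_pos hη (div_pos (intervalValue_pos hd0) hd0)
  have h1 := output_le_bestPayoff hη (V := intervalValue 3) (S := 3) (by norm_num) (by norm_num)
    (optArg η (intervalValue d / d))
  have h2 := bestPayoff_eq (η := η) (V := intervalValue d) (S := d) (fun h => absurd h hd0.ne')
  have h3 : intervalValue 3 = 3 / 2 := by
    rw [intervalValue_of_le (by norm_num) (by norm_num)]; norm_num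
  have h4 := mul_le_mul_of_nonneg_left (intervalValue_le hd0.le) (erf_pos hz).le
  have h5 := mul_pos (mul_pos hη (pow_pos hz 2)) (sub_pos.2 hd)
  unfold frontierPayoff
  rw [h2]
  rw [h3] at h1
  rw [h3]
  linarith

lemma exists_max_frontierPayoff :
    ∃ d, 0 ≤ d ∧ ∀ d', 0 ≤ d' → frontierPayoff η d' ≤ frontierPayoff η d := by
  have hc : ContinuousOn (frontierPayoff η) (Set.Icc 0 3) := by
    refine continuousOn_bestPayoff (V := intervalValue) (S := fun d => d) hη
      continuous_intervalValue.continuousOn continuousOn_id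
      (fun d hd => hd.1) (fun d hd => intervalValue_nonneg hd.1) ?_
    intro d _ h
    rw [h, intervalValue_zero]
  obtain ⟨d, hd, hmax⟩ := isCompact_Icc.exists_isMaxOn ⟨0, by norm_num⟩ hc
  refine ⟨d, hd.1, fun d' h0 => ?_⟩
  rcases le_or_gt d' 3 with h | h
  · exact hmax ⟨h0, h⟩
  · exact (frontierPayoff_lt hη h).le.trans (hmax ⟨by norm_num, le_rfl⟩)

/-- The optimal distance beyond the frontier lies strictly between `2` and `3`. -/
lemma max_frontierPayoff_mem {d : ℝ} (hd : 0 ≤ d)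
    (hmax : ∀ d', 0 ≤ d' → frontierPayoff η d' ≤ frontierPayoff η d) : d ∈ Set.Ioo 2 3 := by
  have hd0 : 0 < d := by
    rcases hd.eq_or_lt with h | h
    · have := hmax 1 (by norm_num)
      rw [← h, frontierPayoff_zero] at this
      exact absurd (frontierPayoff_pos hη one_pos) (not_lt.2 this)
    · exact h
  have hd3 : d ≤ 3 := by
    by_contra h
    exact absurd (hmax 3 (by norm_num)) (not_le.2 (frontierPayoff_lt hη (not_le.1 h)))
  have hv : intervalValue d = d - d ^ 2 / 6 := intervalValue_of_le hd (by linarith)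
  set z := optArg η (intervalValue d / d) with hz
  have hz0 : 0 < z := optArg_pos hη (div_pos (intervalValue_pos hd0) hd0)
  have hR : focRatio η z = 1 - d / 6 := by
    rw [hz, focRatio_optArg hη, hv]; field_simp
  -- With the output frozen at its optimum for `d`, the payoff lies below `frontierPayoff` and
  -- touches it at `d`, so it inherits the maximum and is easy to differentiate.
  have hloc : IsLocalMax (fun t => erf z * (t - t ^ 2 / 6) - η * (z ^ 2 * t)) d := by
    filter_upwards [Ioo_mem_nhds hd0 (by linarith : d < 4)] with t ht
    have h1 := output_le_bestPayoff hη ht.1.le (fun h => absurd h ht.1.ne') z (V := intervalValue t)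
    have h2 := bestPayoff_eq (η := η) (V := intervalValue d) (S := d) (fun h => absurd h hd0.ne')
    have h3 := hmax t ht.1.le
    unfold frontierPayoff at h3
    rw [h2, ← hz, hv] at h3
    rw [intervalValue_of_le ht.1.le ht.2.le] at h1 h3
    exact h1.trans h3
  have hder : HasDerivAt (fun t => erf z * (t - t ^ 2 / 6) - η * (z ^ 2 * t))
      (erf z * (1 - d / 3) - η * z ^ 2) d := by
    have h := (((hasDerivAt_id' d).fun_sub ((hasDerivAt_pow 2 d).div_const 6)).const_mul
      (erf z)).fun_sub (((hasDerivAt_id' d).const_mul (z ^ 2)).const_mul η)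
    refine h.congr_deriv ?_
    push_cast
    ring
  have hfoc := hloc.hasDerivAt_eq_zero hder
  have he := erf_pos hz0
  have hηz := mul_pos hη (pow_pos hz0 2)
  constructor
  -- By `lt_erf` and the condition for the output, `2 η z² < (1 - d / 6) * erf z`. The condition for
  -- the distance turns the left side into `2 (1 - d / 3) * erf z`, whence `d > 2`.
  · have h1 := mul_lt_mul_of_pos_left (lt_erf hz0) (mul_pos hη hz0)
    have h2 : η * z * (Real.sqrt Real.pi * Real.exp (z ^ 2) * erf z) = (1 - d / 6) * erf z := by
      rw [← hR]; unfold focRatio; ring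
    rw [h2] at h1
    by_contra hc
    nlinarith
  · by_contra hc
    nlinarith

end frontier

/-! ### The midpoint against other positions, and the cutoff length. -/

lemma bridgeVar_lt_mid {d X : ℝ} (h0 : 0 < d) (h2 : d < X / 2) :
    bridgeVar d X < bridgeVar (X / 2) X := by
  unfold bridgeVar
  exact div_lt_div_of_pos_right (by nlinarith [sq_pos_of_pos (sub_pos.2 h2)]) (by linarith)

lemma hasDerivAt_excess_div {t : ℝ} (h4 : 4 < t) :
    HasDerivAt (fun t => excess t / t) ((t + 2) * gapRoot t / t ^ 2) t := by
  have h0 : 0 < t := by linarith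
  refine ((hasDerivAt_excess h4).fun_div (hasDerivAt_id' t) h0.ne').congr_deriv ?_
  unfold excess
  field_simp
  ring

lemma splitRatio_mid {X : ℝ} (h0 : 0 < X) (h8 : X ≤ 8) :
    splitRatio (X / 2) X = X / 3 - 2 / 3 * (excess X / X) := by
  rw [splitRatio_eq (by linarith) (by linarith), excess_of_le (t := X / 2) (by linarith)
    (by linarith), excess_of_le (t := X - X / 2) (by linarith) (by linarith)]
  field_simp
  ring

/-- The range matters: up to length 4 the ratio at the midpoint is `X / 3`, which increases. Lengths
above 6 suffice, since by `switchQuad_neg_of_beats_mid` no position matches the midpoint in shorter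
intervals. -/
lemma strictAntiOn_splitRatio_mid :
    StrictAntiOn (fun X => splitRatio (X / 2) X) (Set.Icc 6 8) := by
  have heq : Set.EqOn (fun X => X / 3 - 2 / 3 * (excess X / X))
      (fun X => splitRatio (X / 2) X) (Set.Icc 6 8) := fun X hX =>
    (splitRatio_mid (by linarith [hX.1]) hX.2).symm
  refine StrictAntiOn.congr ?_ heq
  have hd : ∀ X : ℝ, 6 ≤ X → HasDerivAt (fun X => X / 3 - 2 / 3 * (excess X / X)) _ X :=
    fun X hX => ((hasDerivAt_id' X).div_const 3).fun_sub
      ((hasDerivAt_excess_div (by linarith : 4 < X)).const_mul (2 / 3))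
  apply strictAntiOn_of_deriv_neg (convex_Icc 6 8)
  · exact fun X hX => (hd X hX.1).continuousAt.continuousWithinAt
  · intro X hX
    rw [interior_Icc] at hX
    have h6 := hX.1
    rw [(hd X h6.le).deriv]
    have hw : X ^ 2 < 2 * ((X + 2) * gapRoot X) := by
      refine lt_of_pow_lt_pow_left₀ 2
        (mul_nonneg zero_le_two (mul_nonneg (by linarith) (gapRoot_nonneg X))) ?_
      rw [mul_pow, mul_pow, gapRoot_sq (by linarith)]
      have : 0 < X * (3 * X ^ 3 - 48 * X - 64) :=
        mul_pos (by linarith) (by nlinarith [mul_pos (sub_pos.2 h6) (sub_pos.2 h6)])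
      linarith
    have hX0 : 0 < X := by linarith
    have h1 : 1 / 2 < (X + 2) * gapRoot X / X ^ 2 := by
      rw [lt_div_iff₀ (by positivity)]; linarith
    linarith

section cutoff
variable {η : ℝ} (hη : 0 < η)
include hη

/-- The payoff is variance times an increasing function of the ratio, and the midpoint has the
largest variance; only a strictly larger ratio can make up for that. -/
lemma boundedPayoff_lt_mid {d X : ℝ} (h0 : 0 < d) (h2 : d < X / 2)
    (hR : splitRatio d X ≤ splitRatio (X / 2) X) :
    boundedPayoff η d X < boundedPayoff η (X / 2) X := by
  have h1 := bridgeVar_lt_mid h0 h2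
  have h3 := splitRatio_pos h0 (by linarith : d < X)
  have h4 : optValue η (splitRatio d X) ≤ optValue η (splitRatio (X / 2) X) := by
    rcases hR.eq_or_lt with h | h
    · rw [h]
    · exact (optValue_lt_optValue hη h3.le h).le
  have h5 := optValue_pos hη h3
  have h6 := bridgeVar_pos h0 (by linarith : d < X)
  exact mul_lt_mul h1 h4 h5 (by linarith)

/-- A question that beats the midpoint lies where the ratio is decreasing in the distance. -/
lemma switchQuad_neg_of_beats_mid {d X : ℝ} (h0 : 0 < d) (h2 : d < X / 2) (h8 : X ≤ 8)
    (hU : boundedPayoff η (X / 2) X ≤ boundedPayoff η d X) :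
    6 < X ∧ 4 < X - d ∧ switchQuad (X - d) X < 0 := by
  have hR : splitRatio (X / 2) X < splitRatio d X := by
    by_contra h
    exact absurd (boundedPayoff_lt_mid hη h0 h2 (not_lt.1 h)) (not_lt.2 hU)
  have hs := two_lt_sqrt_six
  rcases le_or_gt X 4 with h4 | h4
  · rw [splitRatio_of_le (by linarith) (by linarith) h4,
      splitRatio_of_le h0 (by linarith) h4] at hR
    exact absurd hR (lt_irrefl _)
  rcases le_or_gt X (4 + Real.sqrt 6) with h6 | h6
  · exact absurd (strictMonoOn_splitRatio h4 h6 ⟨h0, h2.le⟩ ⟨by linarith, le_rfl⟩ h2)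
      (not_lt.2 hR.le)
  refine ⟨by linarith, ?_⟩
  rcases h8.eq_or_lt with h8 | h8
  -- At length 8 the quadratic vanishes exactly at `y = 4` and is negative beyond; `dHat_spec` does
  -- not cover this length.
  · subst h8
    refine ⟨by linarith, ?_⟩
    unfold switchQuad
    nlinarith
  · obtain ⟨h1, h3, h5, -⟩ := dHat_spec h6 h8
    have hd : d < dHat 1 X := by
      by_contra h
      exact absurd (strictMonoOn_splitRatio_dHat h6 h8 ⟨not_lt.1 h, h2.le⟩
        ⟨by linarith, le_rfl⟩ h2) (not_lt.2 hR.le)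
    exact ⟨by linarith, h5 d h0 (by linarith) hd⟩

omit hη in
-- At a fixed relative position `κ > 1 / 2` the quadratic divided by `X` is nonincreasing in `X`
-- from 6 on.
lemma switchQuad_neg_of_le {κ X₀ X : ℝ} (hκ : 1 / 2 < κ) (h6 : 6 < X₀) (hX : X₀ ≤ X)
    (h : switchQuad (κ * X₀) X₀ < 0) : switchQuad (κ * X) X < 0 := by
  have e : ∀ X, switchQuad (κ * X) X =
      X * ((X - 4) ^ 3 * (1 - 2 * κ) + 16 * κ - κ ^ 2 * (X * (X - 6) ^ 2)) := by
    intro X; unfold switchQuad; ring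
  rw [e] at h ⊢
  have h0 := neg_of_mul_neg_right h (by linarith : 0 ≤ X₀)
  refine mul_neg_of_pos_of_neg (by linarith) (lt_of_le_of_lt ?_ h0)
  have h1 : (X₀ - 4) ^ 3 ≤ (X - 4) ^ 3 := pow_le_pow_left₀ (by linarith) (by linarith) 3
  have h2 : (X₀ - 6) ^ 2 ≤ (X - 6) ^ 2 := pow_le_pow_left₀ (by linarith) (by linarith) 2
  have h3 : X₀ * (X₀ - 6) ^ 2 ≤ X * (X - 6) ^ 2 :=
    mul_le_mul hX h2 (sq_nonneg _) (by linarith)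
  have h4 := mul_le_mul_of_nonneg_left h3 (sq_nonneg κ)
  have h5 := mul_le_mul_of_nonneg_right h1 (by linarith : 0 ≤ 2 * κ - 1)
  linarith

omit hη in
-- With `y = κ X`, the difference of the two sides carries the sign of the derivative in `X` of the
-- lead in ratio over the midpoint. It reuses the comparison of roots supplied by a negative
-- `switchQuad`.
lemma gapRoot_gap_le {y X : ℝ} (h4 : 4 < y) (hy : y < X) (h6 : 6 < X) (h2 : X < 2 * y)
    (hq : switchQuad y X < 0) :
    (2 * y - X) ^ 2 * ((X + 2) * gapRoot X) ≤ X ^ 2 * ((y + 2) * gapRoot y) := by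
  have h1 := (sign_switchQuad h4 hy h2.le).2 hq
  have h3 : (2 * y - X) * (X + 2) * ((X - 6) * y + 2 * X) ≤ (y + 2) * (X - 4) * X ^ 2 := by
    have e : (y + 2) * (X - 4) * X ^ 2 - (2 * y - X) * (X + 2) * ((X - 6) * y + 2 * X) =
        (X - y) * (2 * (X - 6) * (X + 2) * (y - 4) + (2 * X ^ 2 - 6 * X - 16) * 6) := by
      ring
    have h5 : 0 ≤ (X - y) * (2 * (X - 6) * (X + 2) * (y - 4) + (2 * X ^ 2 - 6 * X - 16) * 6) := by
      refine mul_nonneg (by linarith) (add_nonneg ?_ (by nlinarith))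
      exact mul_nonneg (mul_nonneg (by linarith) (by linarith)) (by linarith)
    linarith
  have h5 : 0 ≤ (2 * y - X) * (X + 2) := mul_nonneg (by linarith) (by linarith)
  have h7 := mul_le_mul_of_nonneg_left h1.le h5
  have h8 := mul_le_mul_of_nonneg_right h3 (gapRoot_nonneg y)
  have h9 : (X - 4) * ((2 * y - X) ^ 2 * ((X + 2) * gapRoot X)) ≤
      (X - 4) * (X ^ 2 * ((y + 2) * gapRoot y)) := by linarith
  exact le_of_mul_le_mul_left h9 (by linarith)

omit hη in
lemma splitRatio_sub_mid {κ X : ℝ} (hX : 0 < X) (h8 : X ≤ 8) (hκ : 1 / 2 < κ) (hκ1 : κ < 1) :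
    splitRatio ((1 - κ) * X) X - splitRatio (X / 2) X =
      1 / (6 * κ * (1 - κ)) *
        (κ * (excess (κ * X) / (κ * X)) - (2 * κ - 1) ^ 2 * (excess X / X)) := by
  have h1 : 0 < (1 - κ) * X := mul_pos (by linarith) hX
  have h3 : 0 < 1 - κ := by linarith
  have h4 : 0 < κ := by linarith
  rw [splitRatio_mid hX h8, splitRatio_eq h1 (by nlinarith),
    excess_of_le (t := (1 - κ) * X) h1.le (by nlinarith),
    show X - (1 - κ) * X = κ * X by ring]
  field_simp
  ring

omit hη in
-- The negative sign of the quadratic persists as the interval grows, so the derivative bound of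
-- `gapRoot_gap_le` holds all the way from `X₀` to `X₁`.
lemma splitRatio_sub_mid_le {κ X₀ X₁ : ℝ} (h6 : 6 < X₀) (hX : X₀ < X₁) (h8 : X₁ ≤ 8)
    (hκ : 1 / 2 < κ) (hκ1 : κ < 1) (h4 : 4 < κ * X₀) (hq : switchQuad (κ * X₀) X₀ < 0) :
    splitRatio ((1 - κ) * X₀) X₀ - splitRatio (X₀ / 2) X₀ ≤
      splitRatio ((1 - κ) * X₁) X₁ - splitRatio (X₁ / 2) X₁ := by
  rw [splitRatio_sub_mid (by linarith) (by linarith) hκ hκ1,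
    splitRatio_sub_mid (by linarith) (by linarith) hκ hκ1]
  have h3 : 0 < 1 - κ := by linarith
  have hκ0 : 0 < κ := by linarith
  refine mul_le_mul_of_nonneg_left ?_ (by positivity)
  have h4' : ∀ X, X₀ ≤ X → 4 < κ * X := fun X hX =>
    h4.trans_le (mul_le_mul_of_nonneg_left hX hκ0.le)
  have hd : ∀ X, X₀ ≤ X → HasDerivAt
      (fun X => κ * (excess (κ * X) / (κ * X)) - (2 * κ - 1) ^ 2 * (excess X / X))
      (κ * ((κ * X + 2) * gapRoot (κ * X) / (κ * X) ^ 2 * κ) -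
        (2 * κ - 1) ^ 2 * ((X + 2) * gapRoot X / X ^ 2)) X := by
    intro X hX
    have hs : HasDerivAt (fun X : ℝ => κ * X) κ X := by
      simpa using (hasDerivAt_id' X).const_mul κ
    have h1 : HasDerivAt (fun X => excess (κ * X) / (κ * X)) _ X :=
      HasDerivAt.comp X (hasDerivAt_excess_div (h4' X hX)) hs
    exact (h1.const_mul κ).fun_sub
      ((hasDerivAt_excess_div (by linarith : 4 < X)).const_mul ((2 * κ - 1) ^ 2))
  have hm : MonotoneOn (fun X => κ * (excess (κ * X) / (κ * X)) -
      (2 * κ - 1) ^ 2 * (excess X / X)) (Set.Icc X₀ X₁) := by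
    apply monotoneOn_of_deriv_nonneg (convex_Icc _ _)
    · exact fun X hX => (hd X hX.1).continuousAt.continuousWithinAt
    · intro X hX
      rw [interior_Icc] at hX
      exact (hd X hX.1.le).differentiableAt.differentiableWithinAt
    · intro X hX
      rw [interior_Icc] at hX
      have hX0 : 0 < X := by linarith [hX.1]
      rw [(hd X hX.1.le).deriv]
      have key := gapRoot_gap_le (h4' X hX.1.le) (by nlinarith) (by linarith [hX.1])
        (by nlinarith) (switchQuad_neg_of_le hκ h6 hX.1.le hq)
      have e : κ * ((κ * X + 2) * gapRoot (κ * X) / (κ * X) ^ 2 * κ) -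
          (2 * κ - 1) ^ 2 * ((X + 2) * gapRoot X / X ^ 2) =
          (X ^ 2 * ((κ * X + 2) * gapRoot (κ * X)) -
            (2 * (κ * X) - X) ^ 2 * ((X + 2) * gapRoot X)) / X ^ 4 := by
        field_simp
      rw [e]
      exact div_nonneg (by linarith) (by positivity)
  exact hm ⟨le_rfl, hX.le⟩ ⟨hX.le, le_rfl⟩ hX.le

/-- Single crossing: if a question at a fixed relative position is at least as good as the
midpoint, then it is strictly better than the midpoint in every longer interval, up to length
`8`. -/
lemma beats_mid_of_lt {κ X₀ X₁ : ℝ} (h0 : 0 < X₀) (hX : X₀ < X₁) (h8 : X₁ ≤ 8)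
    (hκ : 1 / 2 < κ) (hκ1 : κ < 1)
    (hU : boundedPayoff η (X₀ / 2) X₀ ≤ boundedPayoff η ((1 - κ) * X₀) X₀) :
    boundedPayoff η (X₁ / 2) X₁ < boundedPayoff η ((1 - κ) * X₁) X₁ := by
  have h3 : 0 < 1 - κ := by linarith
  obtain ⟨h6, h4, hq⟩ := switchQuad_neg_of_beats_mid hη (mul_pos h3 h0) (by nlinarith)
    (by linarith) hU
  rw [show X₀ - (1 - κ) * X₀ = κ * X₀ by ring] at h4 hq
  have hG := splitRatio_sub_mid_le h6 hX h8 hκ hκ1 h4 hq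
  have hM := strictAntiOn_splitRatio_mid ⟨h6.le, by linarith⟩ ⟨by linarith, h8⟩ hX
  have hm1 := splitRatio_pos (by linarith : 0 < X₁ / 2) (by linarith : X₁ / 2 < X₁)
  have hm0 := splitRatio_pos (by linarith : 0 < X₀ / 2) (by linarith : X₀ / 2 < X₀)
  have hR : splitRatio (X₀ / 2) X₀ < splitRatio ((1 - κ) * X₀) X₀ := by
    by_contra h
    exact absurd (boundedPayoff_lt_mid hη (mul_pos h3 h0) (by nlinarith) (not_lt.1 h))
      (not_lt.2 hU)
  simp only at hM
  have e : ∀ X, 0 < X → boundedPayoff η ((1 - κ) * X) X =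
      X * ((1 - κ) * κ * optValue η (splitRatio ((1 - κ) * X) X)) := by
    intro X hX
    unfold boundedPayoff bestPayoff
    rw [← splitRatio, show bridgeVar ((1 - κ) * X) X = X * ((1 - κ) * κ) by
      unfold bridgeVar; field_simp; ring]
    ring
  have em : ∀ X, 0 < X → boundedPayoff η (X / 2) X =
      X * (optValue η (splitRatio (X / 2) X) / 4) := by
    intro X hX
    unfold boundedPayoff bestPayoff
    rw [← splitRatio, show bridgeVar (X / 2) X = X / 4 by
      unfold bridgeVar; field_simp; ring]
    ring
  rw [e X₀ h0, em X₀ h0] at hU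
  rw [e X₁ (h0.trans hX), em X₁ (h0.trans hX)]
  have hU' := le_of_mul_le_mul_left hU h0
  refine mul_lt_mul_of_pos_left ?_ (h0.trans hX)
  -- The shift is the drop of the midpoint ratio between `X₀` and `X₁`. The ratio at the other
  -- position drops by no more, so lowering it by the same shift underestimates it at `X₁`.
  have hlc := optValue_logConcave hη (sub_pos.2 hM) (by linarith) hR
  rw [sub_sub_cancel] at hlc
  have hge : optValue η (splitRatio ((1 - κ) * X₀) X₀ -
      (splitRatio (X₀ / 2) X₀ - splitRatio (X₁ / 2) X₁)) ≤
      optValue η (splitRatio ((1 - κ) * X₁) X₁) := by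
    rcases (show splitRatio ((1 - κ) * X₀) X₀ -
      (splitRatio (X₀ / 2) X₀ - splitRatio (X₁ / 2) X₁) ≤ splitRatio ((1 - κ) * X₁) X₁ by
        linarith).eq_or_lt with h | h
    · rw [h]
    · exact (optValue_lt_optValue hη (by linarith) h).le
  have p0 := optValue_pos hη hm0
  have p1 := optValue_pos hη hm1
  have p2 := optValue_pos hη (hm0.trans hR)
  have hc : 0 < (1 - κ) * κ := mul_pos h3 (by linarith)
  generalize optValue η (splitRatio ((1 - κ) * X₀) X₀ -
      (splitRatio (X₀ / 2) X₀ - splitRatio (X₁ / 2) X₁)) = b1 at *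
  generalize optValue η (splitRatio ((1 - κ) * X₀) X₀) = b0 at *
  generalize optValue η (splitRatio (X₀ / 2) X₀) = a0 at *
  generalize optValue η (splitRatio (X₁ / 2) X₁) = a1 at *
  generalize optValue η (splitRatio ((1 - κ) * X₁) X₁) = c1 at *
  generalize (1 - κ) * κ = c at *
  have s1 : a0 * (a1 / 4) < a0 * (c * b1) := by
    have t1 := mul_le_mul_of_nonneg_left hU' p1.le
    have t2 := mul_lt_mul_of_pos_left hlc hc
    linarith
  have s2 := lt_of_mul_lt_mul_left s1 p0.le
  exact s2.trans_le (mul_le_mul_of_nonneg_left hge hc.le)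

/-- The midpoint's optimal output can be used at `d`, where the variance, and with it the cost, is
strictly smaller. -/
lemma beats_mid_of_splitValue_le {d X : ℝ} (h0 : 0 < d) (h2 : d < X / 2)
    (hv : splitValue (X / 2) X ≤ splitValue d X) :
    boundedPayoff η (X / 2) X < boundedPayoff η d X := by
  have hb := bridgeVar_lt_mid h0 h2
  have hm := bridgeVar_pos (by linarith : 0 < X / 2) (by linarith : X / 2 < X)
  have hd := bridgeVar_pos h0 (by linarith : d < X)
  have hz := optArg_pos hη (splitRatio_pos (by linarith : 0 < X / 2) (by linarith : X / 2 < X))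
  have h3 := bestPayoff_eq (η := η) (V := splitValue (X / 2) X) (fun h => absurd h hm.ne')
  have h4 := output_le_bestPayoff hη (V := splitValue d X) hd.le (fun h => absurd h hd.ne')
    (optArg η (splitRatio (X / 2) X))
  rw [← splitRatio] at h3
  have h5 := mul_le_mul_of_nonneg_left hv (erf_pos hz).le
  have h6 := mul_lt_mul_of_pos_left hb (mul_pos hη (pow_pos hz 2))
  unfold boundedPayoff
  rw [h3]
  linarith

lemma beats_mid_eight : boundedPayoff η (8 / 2) 8 < boundedPayoff η (15 / 4) 8 := by
  refine beats_mid_of_splitValue_le hη (by norm_num) (by norm_num) ?_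
  have h1 : 1 ≤ gapRoot (17 / 4) := by
    apply Real.le_sqrt_of_sq_le; norm_num
  unfold splitValue
  rw [show (8 : ℝ) - 8 / 2 = 4 by norm_num, show (8 : ℝ) / 2 = 4 by norm_num,
    show (8 : ℝ) - 15 / 4 = 17 / 4 by norm_num,
    intervalValue_of_le (t := 4) (by norm_num) le_rfl,
    intervalValue_of_le (t := 15 / 4) (by norm_num) (by norm_num)]
  unfold intervalValue excess
  linarith

lemma beats_mid_of_eight_lt {X : ℝ} (h8 : 8 < X) :
    boundedPayoff η (X / 2) X < boundedPayoff η 4 X := by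
  refine beats_mid_of_splitValue_le hη (by norm_num) (by linarith) ?_
  have h1 : gapRoot (X / 2) ≤ X / 2 - 2 := by
    refine abs_le_of_sq_le_sq' ?_ (by linarith) |>.2
    rw [gapRoot_sq (by linarith)]; nlinarith
  -- Multiplied by `(X / 2 - 4) / 3`, this is exactly the comparison of benefits: the extra term `X
  -- / 2 - 4` pays for the quadratic loss from an unequal split.
  have h2 : gapRoot (X / 2) + (X / 2 - 4) ≤ gapRoot (X - 4) := by
    refine abs_le_of_sq_le_sq' ?_ (gapRoot_nonneg _) |>.2
    have := gapRoot_sq (by linarith : 4 ≤ X / 2)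
    have := mul_le_mul_of_nonneg_left h1 (by linarith : 0 ≤ X / 2 - 4)
    rw [gapRoot_sq (by linarith : 4 ≤ X - 4)]
    nlinarith
  have h3 := mul_le_mul_of_nonneg_left h2 (by linarith : 0 ≤ X / 2 - 4)
  unfold splitValue
  rw [show X - X / 2 = X / 2 by ring, intervalValue_of_le (t := 4) (by norm_num) le_rfl]
  unfold intervalValue excess
  linarith

lemma continuousOn_boundedPayoff_scaled {κ : ℝ} (h0 : 0 < κ) (h1 : κ < 1) :
    ContinuousOn (fun X => boundedPayoff η (κ * X) X) (Set.Ioi 0) := by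
  have hv := continuous_intervalValue
  have hb : ∀ X ∈ Set.Ioi (0 : ℝ), 0 < bridgeVar (κ * X) X := fun X hX =>
    bridgeVar_pos (mul_pos h0 hX) (mul_lt_of_lt_one_left hX h1)
  refine continuousOn_bestPayoff (V := fun X => splitValue (κ * X) X)
    (S := fun X => bridgeVar (κ * X) X) hη ?_ ?_ (fun X hX => (hb X hX).le) ?_
    (fun X hX h => absurd h (hb X hX).ne')
  · unfold splitValue; fun_prop
  · unfold bridgeVar
    exact ContinuousOn.div (by fun_prop) continuousOn_id (fun X hX => ne_of_gt hX)
  · exact fun X hX => (splitValue_pos (mul_pos h0 hX) (mul_lt_of_lt_one_left hX h1)).le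

/-- The cutoff length below which the midpoint is optimal. -/
lemma exists_cutoff : ∃ Xt ∈ Set.Ioo (4 : ℝ) 8, ∀ X, 0 < X →
    (X ≤ Xt → ∀ d, 0 < d → d < X / 2 → boundedPayoff η d X ≤ boundedPayoff η (X / 2) X) ∧
    (X < Xt → ∀ d, 0 < d → d < X / 2 → boundedPayoff η d X < boundedPayoff η (X / 2) X) ∧
    (Xt < X → ∃ d, 0 < d ∧ d < X / 2 ∧ boundedPayoff η (X / 2) X < boundedPayoff η d X) := by
  -- Here `κ = 1 - d / X` is the share of the longer part; the cutoff will be the infimum of this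
  -- set.
  set B : Set ℝ := {X | (0 < X ∧ X ≤ 8) ∧ ∃ κ, (1 / 2 < κ ∧ κ < 1) ∧
    boundedPayoff η (X / 2) X < boundedPayoff η ((1 - κ) * X) X} with hB
  have h8 : (8 : ℝ) ∈ B := by
    refine ⟨by norm_num, 17 / 32, by norm_num, ?_⟩
    have := beats_mid_eight hη
    norm_num at this ⊢
    exact this
  have h6 : ∀ X ∈ B, 6 ≤ X := by
    rintro X ⟨⟨h0, h8⟩, κ, hκ, hU⟩
    exact (switchQuad_neg_of_beats_mid hη (mul_pos (by linarith) h0) (by nlinarith) h8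
      hU.le).1.le
  have hbdd : BddBelow B := ⟨6, h6⟩
  -- Beating the midpoint strictly is an open condition on the length, so the infimum is not
  -- attained. This makes the midpoint still optimal at the cutoff and keeps the cutoff below 8.
  have hleft : ∀ X ∈ B, ∃ X' ∈ B, X' < X := by
    rintro X ⟨⟨h0, h8⟩, κ, hκ, hU⟩
    have c1 := (continuousOn_boundedPayoff_scaled hη (κ := 1 / 2) (by norm_num)
      (by norm_num)).continuousAt (Ioi_mem_nhds h0)
    have c2 := (continuousOn_boundedPayoff_scaled hη (κ := 1 - κ) (by linarith)
      (by linarith)).continuousAt (Ioi_mem_nhds h0)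
    have hU' : boundedPayoff η (1 / 2 * X) X < boundedPayoff η ((1 - κ) * X) X := by
      rwa [one_div_mul_eq_div]
    have ev := (c1.eventually_lt c2 hU').and (Ioi_mem_nhds h0)
    obtain ⟨X', ⟨h1, h2⟩, h3⟩ :=
      ((ev.filter_mono nhdsWithin_le_nhds).and (self_mem_nhdsWithin (s := Set.Iio X))).exists
    have h3' : X' < X := h3
    refine ⟨X', ⟨⟨h2, by linarith⟩, κ, hκ, ?_⟩, h3⟩
    rwa [one_div_mul_eq_div] at h1
  have hnot : sInf B ∉ B := by
    intro h
    obtain ⟨X', hX', hlt⟩ := hleft _ h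
    exact absurd (csInf_le hbdd hX') (not_le.2 hlt)
  have hge : 6 ≤ sInf B := le_csInf ⟨8, h8⟩ h6
  have hlt : sInf B < 8 :=
    lt_of_le_of_ne (csInf_le hbdd h8) (fun h => hnot (by rwa [h]))
  have hκd : ∀ X d : ℝ, 0 < X → 0 < d → d < X / 2 →
      1 / 2 < 1 - d / X ∧ 1 - d / X < 1 ∧ (1 - (1 - d / X)) * X = d := by
    intro X d hX h0 h2
    have h3 : d / X < 1 / 2 := by rw [div_lt_iff₀ hX]; linarith
    have h4 : 0 < d / X := div_pos h0 hX
    refine ⟨by linarith, by linarith, ?_⟩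
    rw [sub_sub_cancel, div_mul_cancel₀ _ hX.ne']
  have hnB : ∀ X, 0 < X → X ≤ 8 → X ∉ B → ∀ d, 0 < d → d < X / 2 →
      boundedPayoff η d X ≤ boundedPayoff η (X / 2) X := by
    intro X hX hX8 hXB d h0 h2
    by_contra h
    obtain ⟨k1, k2, k3⟩ := hκd X d hX h0 h2
    exact hXB ⟨⟨hX, hX8⟩, 1 - d / X, ⟨k1, k2⟩, by rw [k3]; exact not_le.1 h⟩
  refine ⟨sInf B, ⟨by linarith, hlt⟩, fun X hX => ⟨?_, ?_, ?_⟩⟩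
  · intro h
    refine hnB X hX (by linarith) ?_
    rcases h.eq_or_lt with h | h
    · rwa [h]
    · exact notMem_of_lt_csInf h hbdd
  -- A mere tie below the cutoff would, by single crossing, put the cutoff itself into `B`.
  · intro h d h0 h2
    by_contra hc
    obtain ⟨k1, k2, k3⟩ := hκd X d hX h0 h2
    exact hnot ⟨⟨by linarith, hlt.le⟩, 1 - d / X, ⟨k1, k2⟩,
      beats_mid_of_lt hη hX h hlt.le k1 k2 (by rw [k3]; exact not_lt.1 hc)⟩
  · intro h
    rcases le_or_gt X 8 with h8' | h8'
    · obtain ⟨X', ⟨⟨h0, -⟩, κ, hκ, hU⟩, hlt'⟩ := exists_lt_of_csInf_lt ⟨8, h8⟩ h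
      exact ⟨(1 - κ) * X, mul_pos (by linarith) hX, by nlinarith,
        beats_mid_of_lt hη h0 hlt' h8' hκ.1 hκ.2 hU.le⟩
    · exact ⟨4, by norm_num, by linarith, beats_mid_of_eight_lt hη h8'⟩

lemma exists_max_boundedPayoff {X : ℝ} (hX : 0 < X) :
    ∃ d, 0 ≤ d ∧ d ≤ X / 2 ∧
      ∀ d', 0 ≤ d' → d' ≤ X → boundedPayoff η d' X ≤ boundedPayoff η d X := by
  have hv := continuous_intervalValue
  have hc : ContinuousOn (fun d => boundedPayoff η d X) (Set.Icc 0 (X / 2)) := by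
    have hpos : ∀ d ∈ Set.Icc 0 (X / 2), d = 0 ∨ (0 < d ∧ d < X) := by
      intro d hd
      rcases hd.1.eq_or_lt with h | h
      · exact Or.inl h.symm
      · exact Or.inr ⟨h, by linarith [hd.2]⟩
    refine continuousOn_bestPayoff (V := fun d => splitValue d X)
      (S := fun d => bridgeVar d X) hη ?_ ?_ ?_ ?_ ?_
    · unfold splitValue; fun_prop
    · unfold bridgeVar; fun_prop
    · intro d hd
      rcases hpos d hd with h | h
      · rw [h, bridgeVar_zero]
      · exact (bridgeVar_pos h.1 h.2).le
    · intro d hd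
      rcases hpos d hd with h | h
      · rw [h, splitValue_zero]
      · exact (splitValue_pos h.1 h.2).le
    · intro d hd h0
      rcases hpos d hd with h | h
      · rw [h, splitValue_zero]
      · exact absurd h0 (bridgeVar_pos h.1 h.2).ne'
  obtain ⟨d, hd, hmax⟩ := isCompact_Icc.exists_isMaxOn ⟨0, by constructor <;> linarith⟩ hc
  refine ⟨d, hd.1, hd.2, fun d' h0 h1 => ?_⟩
  rcases le_total d' (X / 2) with h | h
  · exact hmax ⟨h0, h⟩
  · rw [← boundedPayoff_symm η d' X]
    exact hmax ⟨by linarith, by linarith⟩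

lemma boundedPayoff_pos {d X : ℝ} (h0 : 0 < d) (h1 : d < X) : 0 < boundedPayoff η d X :=
  bestPayoff_pos hη (bridgeVar_pos h0 h1) (splitValue_pos h0 h1)

omit hη in
lemma boundedPayoff_zero (X : ℝ) : boundedPayoff η 0 X = 0 := by
  simp [boundedPayoff, bestPayoff, bridgeVar_zero]

end cutoff

end ResearchModel

/-! ### Variance, gain and the integral of the gain in the model. -/

namespace ResearchModel

open MeasureTheory

lemma conjVar_of_mem_Ico {K : Finset ℝ} {l r t : ℝ} (hl : l ∈ K) (hr : r ∈ K)
    (hK : ∀ k ∈ K, k ≤ l ∨ r ≤ k) (ht : t ∈ Set.Ico l r) :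
    conjVar K t = (r - t) * (t - l) / (r - l) := by
  have hL : (K.filter (fun k => k ≤ t)).Nonempty := ⟨l, Finset.mem_filter.2 ⟨hl, ht.1⟩⟩
  have hR : (K.filter (fun k => t < k)).Nonempty := ⟨r, Finset.mem_filter.2 ⟨hr, ht.2⟩⟩
  have e1 : (K.filter (fun k => k ≤ t)).max' hL = l := by
    apply le_antisymm
    · refine Finset.max'_le _ _ _ fun k hk => ?_
      obtain ⟨h1, h2⟩ := Finset.mem_filter.1 hk
      rcases hK k h1 with h | h
      · exact h
      · exact absurd ht.2 (not_lt.2 (h.trans h2))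
    · exact Finset.le_max' _ _ (Finset.mem_filter.2 ⟨hl, ht.1⟩)
  have e2 : (K.filter (fun k => t < k)).min' hR = r := by
    apply le_antisymm
    · exact Finset.min'_le _ _ (Finset.mem_filter.2 ⟨hr, ht.2⟩)
    · refine Finset.le_min' _ _ _ fun k hk => ?_
      obtain ⟨h1, h2⟩ := Finset.mem_filter.1 hk
      rcases hK k h1 with h | h
      · exact absurd h2 (not_lt.2 (h.trans ht.1))
      · exact h
  rw [conjVar, dif_pos hL, dif_pos hR, e1, e2]

lemma conjVar_of_lt {K : Finset ℝ} {m t : ℝ} (hm : m ∈ K) (hK : ∀ k ∈ K, m ≤ k) (ht : t < m) :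
    conjVar K t = m - t := by
  have hL : ¬ (K.filter (fun k => k ≤ t)).Nonempty := by
    rintro ⟨k, hk⟩
    obtain ⟨h1, h2⟩ := Finset.mem_filter.1 hk
    exact absurd ht (not_lt.2 ((hK k h1).trans h2))
  have hR : (K.filter (fun k => t < k)).Nonempty := ⟨m, Finset.mem_filter.2 ⟨hm, ht⟩⟩
  have e2 : (K.filter (fun k => t < k)).min' hR = m :=
    le_antisymm (Finset.min'_le _ _ (Finset.mem_filter.2 ⟨hm, ht⟩))
      (Finset.le_min' _ _ _ fun k hk => hK k (Finset.mem_filter.1 hk).1)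
  rw [conjVar, dif_neg hL, dif_pos hR, e2]

lemma conjVar_of_ge {K : Finset ℝ} {m t : ℝ} (hm : m ∈ K) (hK : ∀ k ∈ K, k ≤ m) (ht : m ≤ t) :
    conjVar K t = t - m := by
  have hR : ¬ (K.filter (fun k => t < k)).Nonempty := by
    rintro ⟨k, hk⟩
    obtain ⟨h1, h2⟩ := Finset.mem_filter.1 hk
    exact absurd h2 (not_lt.2 ((hK k h1).trans ht))
  have hL : (K.filter (fun k => k ≤ t)).Nonempty := ⟨m, Finset.mem_filter.2 ⟨hm, ht⟩⟩
  have e2 : (K.filter (fun k => k ≤ t)).max' hL = m :=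
    le_antisymm (Finset.max'_le _ _ _ fun k hk => hK k (Finset.mem_filter.1 hk).1)
      (Finset.le_max' _ _ (Finset.mem_filter.2 ⟨hm, ht⟩))
  rw [conjVar, dif_pos hL, dif_neg hR, e2]

lemma exists_pred {K : Finset ℝ} {t : ℝ} (h : ∃ k ∈ K, k ≤ t) :
    ∃ a ∈ K, a ≤ t ∧ ∀ k ∈ K, k ≤ t → k ≤ a := by
  obtain ⟨k, hk, hkt⟩ := h
  have hL : (K.filter (fun k => k ≤ t)).Nonempty := ⟨k, Finset.mem_filter.2 ⟨hk, hkt⟩⟩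
  have hm := Finset.mem_filter.1 (Finset.max'_mem _ hL)
  exact ⟨_, hm.1, hm.2, fun k hk hkt => Finset.le_max' _ _ (Finset.mem_filter.2 ⟨hk, hkt⟩)⟩

lemma exists_succ {K : Finset ℝ} {t : ℝ} (h : ∃ k ∈ K, t < k) :
    ∃ a ∈ K, t < a ∧ ∀ k ∈ K, t < k → a ≤ k := by
  obtain ⟨k, hk, hkt⟩ := h
  have hL : (K.filter (fun k => t < k)).Nonempty := ⟨k, Finset.mem_filter.2 ⟨hk, hkt⟩⟩
  have hm := Finset.mem_filter.1 (Finset.min'_mem _ hL)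
  exact ⟨_, hm.1, hm.2, fun k hk hkt => Finset.min'_le _ _ (Finset.mem_filter.2 ⟨hk, hkt⟩)⟩

/-- A discovery does not affect the questions on the other side of a known answer to its left. -/
lemma conjVar_insert_of_lt {K : Finset ℝ} {l x t : ℝ} (hl : l ∈ K) (hx : l ≤ x) (ht : t < l) :
    conjVar (insert x K) t = conjVar K t := by
  obtain ⟨b, hb, hbt, hb'⟩ := exists_succ ⟨l, hl, ht⟩
  have hbx : b ≤ x := (hb' l hl ht).trans hx
  by_cases h : ∃ k ∈ K, k ≤ t
  · obtain ⟨a, ha, hat, ha'⟩ := exists_pred h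
    have hK : ∀ k ∈ K, k ≤ a ∨ b ≤ k := fun k hk =>
      (le_or_gt k t).imp (ha' k hk) (hb' k hk)
    rw [conjVar_of_mem_Ico ha hb hK ⟨hat, hbt⟩,
      conjVar_of_mem_Ico (Finset.mem_insert_of_mem ha) (Finset.mem_insert_of_mem hb)
        (Finset.forall_mem_insert _ _ _ |>.2 ⟨Or.inr hbx, hK⟩) ⟨hat, hbt⟩]
  · push Not at h
    have hK : ∀ k ∈ K, b ≤ k := fun k hk => hb' k hk (h k hk)
    rw [conjVar_of_lt hb hK hbt, conjVar_of_lt (Finset.mem_insert_of_mem hb)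
      (Finset.forall_mem_insert _ _ _ |>.2 ⟨hbx, hK⟩) hbt]

/-- A discovery does not affect the questions on the other side of a known answer to its right. -/
lemma conjVar_insert_of_ge {K : Finset ℝ} {r x t : ℝ} (hr : r ∈ K) (hx : x ≤ r) (ht : r ≤ t) :
    conjVar (insert x K) t = conjVar K t := by
  obtain ⟨a, ha, hat, ha'⟩ := exists_pred ⟨r, hr, ht⟩
  have hax : x ≤ a := hx.trans (ha' r hr ht)
  by_cases h : ∃ k ∈ K, t < k
  · obtain ⟨b, hb, hbt, hb'⟩ := exists_succ h
    have hK : ∀ k ∈ K, k ≤ a ∨ b ≤ k := fun k hk =>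
      (le_or_gt k t).imp (ha' k hk) (hb' k hk)
    rw [conjVar_of_mem_Ico ha hb hK ⟨hat, hbt⟩,
      conjVar_of_mem_Ico (Finset.mem_insert_of_mem ha) (Finset.mem_insert_of_mem hb)
        (Finset.forall_mem_insert _ _ _ |>.2 ⟨Or.inl hax, hK⟩) ⟨hat, hbt⟩]
  · push Not at h
    have hK : ∀ k ∈ K, k ≤ a := fun k hk => ha' k hk (h k hk)
    rw [conjVar_of_ge ha hK hat, conjVar_of_ge (Finset.mem_insert_of_mem ha)
      (Finset.forall_mem_insert _ _ _ |>.2 ⟨hax, hK⟩) hat]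

/-- The gain of the decision maker on a question. -/
noncomputable def gain (q : ℝ) (K : Finset ℝ) (t : ℝ) : ℝ := max ((q - conjVar K t) / q) 0

/-- The gain on the questions of a bounded area, extended by zero. -/
noncomputable def bridgeGain (q l r : ℝ) : ℝ → ℝ :=
  (Set.Ico l r).indicator fun t => max ((q - (r - t) * (t - l) / (r - l)) / q) 0

/-- The gain to the right of a known answer at the origin, extended by zero. -/
noncomputable def rightGain (q : ℝ) : ℝ → ℝ := (Set.Ici 0).indicator fun t => max ((q - t) / q) 0

/-- The gain to the left of a known answer at the origin, extended by zero. -/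
noncomputable def leftGain (q : ℝ) : ℝ → ℝ := (Set.Iio 0).indicator fun t => max ((q + t) / q) 0

lemma integrable_bridgeGain (q l r : ℝ) : Integrable (bridgeGain q l r) := by
  rw [bridgeGain, integrable_indicator_iff measurableSet_Ico]
  have : Continuous fun t : ℝ => max ((q - (r - t) * (t - l) / (r - l)) / q) 0 := by fun_prop
  exact (this.continuousOn.integrableOn_compact isCompact_Icc).mono_set Set.Ico_subset_Icc_self

lemma integrable_rightGain {q : ℝ} (hq : 0 < q) : Integrable (rightGain q) := by
  have hc : Continuous fun t : ℝ => max ((q - t) / q) 0 := by fun_prop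
  have e : rightGain q = (Set.Icc 0 q).indicator fun t => max ((q - t) / q) 0 := by
    funext t
    by_cases h0 : 0 ≤ t
    · by_cases h1 : t ≤ q
      · rw [rightGain, Set.indicator_of_mem (Set.mem_Ici.2 h0), Set.indicator_of_mem (Set.mem_Icc.2 ⟨h0, h1⟩)]
      · rw [rightGain, Set.indicator_of_mem (Set.mem_Ici.2 h0),
          Set.indicator_of_notMem (fun h => h1 h.2)]
        exact max_eq_right (div_nonpos_of_nonpos_of_nonneg (by linarith) hq.le)
    · rw [rightGain, Set.indicator_of_notMem (fun h => h0 (Set.mem_Ici.1 h)),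
        Set.indicator_of_notMem (fun h => h0 h.1)]
  rw [e, integrable_indicator_iff measurableSet_Icc]
  exact hc.continuousOn.integrableOn_compact isCompact_Icc

lemma integrable_leftGain {q : ℝ} (hq : 0 < q) : Integrable (leftGain q) := by
  have hc : Continuous fun t : ℝ => max ((q + t) / q) 0 := by fun_prop
  have e : leftGain q = (Set.Ico (-q) 0).indicator fun t => max ((q + t) / q) 0 := by
    funext t
    by_cases h0 : t < 0
    · by_cases h1 : -q ≤ t
      · rw [leftGain, Set.indicator_of_mem (Set.mem_Iio.2 h0), Set.indicator_of_mem (Set.mem_Ico.2 ⟨h1, h0⟩)]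
      · rw [leftGain, Set.indicator_of_mem (Set.mem_Iio.2 h0),
          Set.indicator_of_notMem (fun h => h1 h.1)]
        exact max_eq_right (div_nonpos_of_nonpos_of_nonneg (by linarith) hq.le)
    · rw [leftGain, Set.indicator_of_notMem (fun h => h0 (Set.mem_Iio.1 h)),
        Set.indicator_of_notMem (fun h => h0 h.2)]
  rw [e, integrable_indicator_iff measurableSet_Ico]
  exact (hc.continuousOn.integrableOn_compact isCompact_Icc).mono_set Set.Ico_subset_Icc_self

lemma rightGain_sub_of_le {q m t : ℝ} (h : m ≤ t) :
    rightGain q (t - m) = max ((q - (t - m)) / q) 0 :=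
  Set.indicator_of_mem (Set.mem_Ici.2 (sub_nonneg.2 h)) _

lemma rightGain_sub_of_lt {q m t : ℝ} (h : t < m) : rightGain q (t - m) = 0 :=
  Set.indicator_of_notMem (fun h' => absurd (sub_nonneg.1 h') (not_le.2 h)) _

lemma leftGain_sub_of_lt {q m t : ℝ} (h : t < m) :
    leftGain q (t - m) = max ((q - (m - t)) / q) 0 := by
  rw [leftGain, Set.indicator_of_mem (Set.mem_Iio.2 (sub_neg.2 h))]
  congr 2; ring

lemma leftGain_sub_of_le {q m t : ℝ} (h : m ≤ t) : leftGain q (t - m) = 0 :=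
  Set.indicator_of_notMem (fun h' => absurd (sub_neg.1 h') (not_lt.2 h)) _

lemma bridgeGain_of_lt {q l r t : ℝ} (h : t < l) : bridgeGain q l r t = 0 :=
  Set.indicator_of_notMem (fun h' => absurd h'.1 (not_le.2 h)) _

lemma bridgeGain_of_ge {q l r t : ℝ} (h : r ≤ t) : bridgeGain q l r t = 0 :=
  Set.indicator_of_notMem (fun h' => absurd h'.2 (not_lt.2 h)) _

lemma gain_eq_bridgeGain {q : ℝ} {K : Finset ℝ} {l r t : ℝ} (hl : l ∈ K) (hr : r ∈ K)
    (hK : ∀ k ∈ K, k ≤ l ∨ r ≤ k) (ht : t ∈ Set.Ico l r) :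
    gain q K t = bridgeGain q l r t := by
  rw [bridgeGain, Set.indicator_of_mem ht, gain, conjVar_of_mem_Ico hl hr hK ht]

lemma gain_insert_of_mem_Ioo {q : ℝ} {K : Finset ℝ} {l r x : ℝ} (hl : l ∈ K) (hr : r ∈ K)
    (hK : ∀ k ∈ K, k ≤ l ∨ r ≤ k) (hx : x ∈ Set.Ioo l r) (t : ℝ) :
    gain q (insert x K) t =
      gain q K t + (bridgeGain q l x t + bridgeGain q x r t - bridgeGain q l r t) := by
  have hx1 := hx.1
  have hx2 := hx.2
  rcases lt_or_ge t l with h1 | h1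
  · rw [gain, conjVar_insert_of_lt hl hx1.le h1, bridgeGain_of_lt h1,
      bridgeGain_of_lt (h1.trans hx1), bridgeGain_of_lt h1, gain]
    ring
  rcases lt_or_ge t x with h2 | h2
  · rw [gain_eq_bridgeGain hl hr hK ⟨h1, h2.trans hx2⟩, bridgeGain_of_lt h2,
      gain_eq_bridgeGain (Finset.mem_insert_of_mem hl) (Finset.mem_insert_self _ _) (r := x) ?_
        ⟨h1, h2⟩]
    · ring
    · exact Finset.forall_mem_insert _ _ _ |>.2
        ⟨Or.inr le_rfl, fun k hk => (hK k hk).imp_right (hx2.le.trans ·)⟩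
  rcases lt_or_ge t r with h3 | h3
  · rw [gain_eq_bridgeGain hl hr hK ⟨h1, h3⟩, bridgeGain_of_ge h2,
      gain_eq_bridgeGain (Finset.mem_insert_self _ _) (Finset.mem_insert_of_mem hr) (l := x) ?_
        ⟨h2, h3⟩]
    · ring
    · exact Finset.forall_mem_insert _ _ _ |>.2
        ⟨Or.inl le_rfl, fun k hk => (hK k hk).imp_left (·.trans hx1.le)⟩
  · rw [gain, conjVar_insert_of_ge hr hx2.le h3, bridgeGain_of_ge h3, bridgeGain_of_ge h3,
      bridgeGain_of_ge h2, gain]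
    ring

/-- Writing the change as a sum of integrable pieces serves twice: for the benefit, and for
integrability of the gain by adding known answers from left to right. -/
lemma gain_insert_of_gt {q : ℝ} {K : Finset ℝ} {m x : ℝ} (hm : m ∈ K) (hK : ∀ k ∈ K, k ≤ m)
    (hx : m < x) (t : ℝ) :
    gain q (insert x K) t =
      gain q K t + (bridgeGain q m x t + rightGain q (t - x) - rightGain q (t - m)) := by
  rcases lt_or_ge t m with h1 | h1
  · rw [gain, conjVar_insert_of_lt hm hx.le h1, bridgeGain_of_lt h1,
      rightGain_sub_of_lt (h1.trans hx), rightGain_sub_of_lt h1, gain]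
    ring
  rcases lt_or_ge t x with h2 | h2
  · rw [gain_eq_bridgeGain (Finset.mem_insert_of_mem hm) (Finset.mem_insert_self _ _) (r := x)
        (Finset.forall_mem_insert _ _ _ |>.2 ⟨Or.inr le_rfl, fun k hk => Or.inl (hK k hk)⟩)
        ⟨h1, h2⟩, rightGain_sub_of_lt h2, rightGain_sub_of_le h1, gain, conjVar_of_ge hm hK h1]
    ring
  · rw [gain, conjVar_of_ge (Finset.mem_insert_self x K)
        (Finset.forall_mem_insert _ _ _ |>.2 ⟨le_rfl, fun k hk => (hK k hk).trans hx.le⟩) h2,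
      bridgeGain_of_ge h2, rightGain_sub_of_le h2, rightGain_sub_of_le h1, gain,
      conjVar_of_ge hm hK h1]
    ring

lemma gain_insert_of_lt {q : ℝ} {K : Finset ℝ} {m x : ℝ} (hm : m ∈ K) (hK : ∀ k ∈ K, m ≤ k)
    (hx : x < m) (t : ℝ) :
    gain q (insert x K) t =
      gain q K t + (bridgeGain q x m t + leftGain q (t - x) - leftGain q (t - m)) := by
  rcases lt_or_ge t x with h1 | h1
  · rw [gain, conjVar_of_lt (Finset.mem_insert_self x K)
        (Finset.forall_mem_insert _ _ _ |>.2 ⟨le_rfl, fun k hk => hx.le.trans (hK k hk)⟩) h1,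
      bridgeGain_of_lt h1, leftGain_sub_of_lt h1, leftGain_sub_of_lt (h1.trans hx), gain,
      conjVar_of_lt hm hK (h1.trans hx)]
    ring
  rcases lt_or_ge t m with h2 | h2
  · rw [gain_eq_bridgeGain (Finset.mem_insert_self _ _) (Finset.mem_insert_of_mem hm) (l := x)
        (Finset.forall_mem_insert _ _ _ |>.2 ⟨Or.inl le_rfl, fun k hk => Or.inr (hK k hk)⟩)
        ⟨h1, h2⟩, leftGain_sub_of_le h1, leftGain_sub_of_lt h2, gain, conjVar_of_lt hm hK h2]
    ring
  · rw [gain, conjVar_insert_of_ge hm hx.le h2, bridgeGain_of_ge h2, leftGain_sub_of_le h2,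
      leftGain_sub_of_le (hx.le.trans h2), gain]
    ring

lemma gain_singleton (q m t : ℝ) :
    gain q {m} t = leftGain q (t - m) + rightGain q (t - m) := by
  rcases lt_or_ge t m with h | h
  · rw [gain, conjVar_of_lt (Finset.mem_singleton_self m)
      (fun k hk => (Finset.mem_singleton.1 hk).ge) h, leftGain_sub_of_lt h, rightGain_sub_of_lt h,
      add_zero]
  · rw [gain, conjVar_of_ge (Finset.mem_singleton_self m)
      (fun k hk => (Finset.mem_singleton.1 hk).le) h, leftGain_sub_of_le h, rightGain_sub_of_le h,
      zero_add]

lemma integrable_gain {q : ℝ} (hq : 0 < q) {K : Finset ℝ} (hK : K.Nonempty) :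
    Integrable (gain q K) := by
  induction K using Finset.induction_on_max with
  | empty => exact absurd hK Finset.not_nonempty_empty
  | insert a s ha ih =>
    rcases s.eq_empty_or_nonempty with h | h
    · subst h
      have e : gain q (insert a ∅) = fun t => leftGain q (t - a) + rightGain q (t - a) := by
        funext t
        rw [insert_empty_eq]
        exact gain_singleton q a t
      rw [e]
      exact ((integrable_leftGain hq).comp_sub_right a).add
        ((integrable_rightGain hq).comp_sub_right a)
    · have hm := s.max'_mem h
      have e : gain q (insert a s) = fun t => gain q s t + (bridgeGain q (s.max' h) a t +
          rightGain q (t - a) - rightGain q (t - s.max' h)) := by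
        funext t
        exact gain_insert_of_gt hm (fun k hk => s.le_max' k hk) (ha _ hm) t
      rw [e]
      exact (ih h).add (((integrable_bridgeGain _ _ _).add
        ((integrable_rightGain hq).comp_sub_right a)).sub
          ((integrable_rightGain hq).comp_sub_right _))

lemma benefit_eq_integral {q : ℝ} (hq : 0 < q) {K : Finset ℝ} (hK : K.Nonempty) {x : ℝ}
    {f : ℝ → ℝ} (hf : ∀ t, gain q (insert x K) t = gain q K t + f t) :
    benefit q K x = ∫ t, f t := by
  have e : f = fun t => gain q (insert x K) t - gain q K t := by
    funext t; rw [hf]; ring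
  rw [e, integral_sub (integrable_gain hq (Finset.insert_nonempty _ _)) (integrable_gain hq hK)]
  rfl

/-- The value of an interval in units of the error tolerance. -/
lemma integral_unit_bridge {X : ℝ} (hX : 0 < X) :
    ∫ s in (0 : ℝ)..X, max (1 - (X - s) * s / X) 0 = intervalValue X := by
  have hd : ∀ s : ℝ, HasDerivAt (fun s => s - s ^ 2 / 2 + s ^ 3 / (3 * X))
      (1 - (X - s) * s / X) s := by
    intro s
    have h := ((hasDerivAt_id' s).fun_sub ((hasDerivAt_pow 2 s).div_const 2)).fun_add
      ((hasDerivAt_pow 3 s).div_const (3 * X))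
    refine h.congr_deriv ?_
    push_cast
    field_simp
    ring
  have hc : Continuous fun s : ℝ => 1 - (X - s) * s / X := by fun_prop
  have hpoly : ∀ a b : ℝ, ∫ s in a..b, (1 - (X - s) * s / X) =
      (b - b ^ 2 / 2 + b ^ 3 / (3 * X)) - (a - a ^ 2 / 2 + a ^ 3 / (3 * X)) := fun a b =>
    intervalIntegral.integral_eq_sub_of_hasDerivAt (fun s _ => hd s) (hc.intervalIntegrable _ _)
  have hpos : ∀ a b : ℝ, a ≤ b → (∀ s ∈ Set.Icc a b, (X - s) * s ≤ X) →
      ∫ s in a..b, max (1 - (X - s) * s / X) 0 =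
      (b - b ^ 2 / 2 + b ^ 3 / (3 * X)) - (a - a ^ 2 / 2 + a ^ 3 / (3 * X)) := by
    intro a b hab h
    rw [← hpoly]
    refine intervalIntegral.integral_congr fun s hs => ?_
    rw [Set.uIcc_of_le hab] at hs
    refine max_eq_left (sub_nonneg.2 ?_)
    rw [div_le_one hX]
    exact h s hs
  rcases le_or_gt X 4 with h4 | h4
  · rw [hpos 0 X hX.le, intervalValue_of_le hX.le h4]
    · field_simp
      ring
    · intro s hs
      nlinarith [sq_nonneg (s - X / 2)]
  · have hw := gapRoot_sq h4.le
    have hw0 := gapRoot_pos h4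
    have hwX : gapRoot X < X := lt_of_pow_lt_pow_left₀ 2 hX.le (by rw [hw]; nlinarith)
    set w := gapRoot X with hwdef
    have hcm : Continuous fun s : ℝ => max (1 - (X - s) * s / X) 0 := by fun_prop
    -- The variance equals 1 at `X / 2 ± w / 2` and is at least 1 in between, where the truncation
    -- makes the integrand zero.
    have hfac : ∀ s, X - (X - s) * s = (s - (X / 2 - w / 2)) * (s - (X / 2 + w / 2)) := by
      intro s; linear_combination (1 / 4) * hw
    rw [← intervalIntegral.integral_add_adjacent_intervals (b := X / 2 + w / 2)
      (hcm.intervalIntegrable _ _) (hcm.intervalIntegrable _ _),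
      ← intervalIntegral.integral_add_adjacent_intervals (b := X / 2 - w / 2)
      (hcm.intervalIntegrable _ _) (hcm.intervalIntegrable _ _),
      hpos 0 (X / 2 - w / 2) (by linarith), hpos (X / 2 + w / 2) X (by linarith)]
    · have hz : ∫ s in (X / 2 - w / 2)..(X / 2 + w / 2), max (1 - (X - s) * s / X) 0 = 0 := by
        rw [intervalIntegral.integral_congr (g := fun _ => (0 : ℝ))]
        · simp
        · intro s hs
          rw [Set.uIcc_of_le (by linarith)] at hs
          refine max_eq_right (sub_nonpos.2 ?_)
          rw [one_le_div hX]
          have := mul_nonneg (sub_nonneg.2 hs.1) (sub_nonneg.2 hs.2)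
          linarith [hfac s]
      rw [hz, intervalValue, excess, ← hwdef]
      field_simp
      linear_combination (-12 * w) * hw
    · intro s hs
      have := mul_nonneg (sub_nonneg.2 (show X / 2 - w / 2 ≤ s by linarith [hs.1]))
        (sub_nonneg.2 hs.1)
      linarith [hfac s]
    · intro s hs
      have := mul_nonneg (sub_nonneg.2 hs.2) (sub_nonneg.2 (show s ≤ X / 2 + w / 2 by
        linarith [hs.2]))
      linarith [hfac s]

lemma integral_bridgeGain {q l r : ℝ} (hq : 0 < q) (hlr : l < r) :
    ∫ t, bridgeGain q l r t = q * intervalValue ((r - l) / q) := by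
  have h1 : ∫ t, bridgeGain q l r t =
      ∫ t in l..r, max ((q - (r - t) * (t - l) / (r - l)) / q) 0 := by
    rw [bridgeGain, integral_indicator measurableSet_Ico, intervalIntegral.integral_of_le hlr.le,
      integral_Ico_eq_integral_Ioo, integral_Ioc_eq_integral_Ioo]
  have hX : 0 < (r - l) / q := div_pos (sub_pos.2 hlr) hq
  rw [h1, ← integral_unit_bridge hX]
  have h2 := intervalIntegral.smul_integral_comp_mul_add (a := 0) (b := (r - l) / q)
    (fun t => max ((q - (r - t) * (t - l) / (r - l)) / q) 0) q l
  rw [mul_zero, zero_add, mul_div_cancel₀ _ hq.ne', sub_add_cancel, smul_eq_mul] at h2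
  rw [← h2]
  congr 1
  refine intervalIntegral.integral_congr fun s _ => ?_
  have : 0 < r - l := sub_pos.2 hlr
  congr 1
  field_simp
  ring

end ResearchModel

/-! ### Benefit, variance and novelty in each area. -/

namespace ResearchModel

open MeasureTheory

lemma integral_add_sub {f g h : ℝ → ℝ} (hf : Integrable f) (hg : Integrable g)
    (hh : Integrable h) :
    ∫ t, (f t + g t - h t) = (∫ t, f t) + (∫ t, g t) - ∫ t, h t := by
  rw [← integral_add hf hg]
  exact integral_sub (hf.add hg) hh

lemma benefit_of_mem_Ioo {q : ℝ} (hq : 0 < q) {K : Finset ℝ} {l r x : ℝ} (hl : l ∈ K)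
    (hr : r ∈ K) (hK : ∀ k ∈ K, k ≤ l ∨ r ≤ k) (hx : x ∈ Set.Ioo l r) :
    benefit q K x = q * splitValue ((x - l) / q) ((r - l) / q) := by
  rw [benefit_eq_integral hq ⟨l, hl⟩ (gain_insert_of_mem_Ioo hl hr hK hx),
    integral_add_sub (integrable_bridgeGain q l x) (integrable_bridgeGain q x r)
      (integrable_bridgeGain q l r),
    integral_bridgeGain hq hx.1, integral_bridgeGain hq hx.2,
    integral_bridgeGain hq (hx.1.trans hx.2), splitValue,
    show (r - l) / q - (x - l) / q = (r - x) / q by ring]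
  ring

/-- The gains beyond the old and the new frontier are translates of each other and cancel; the new
interval remains. -/
lemma benefit_of_gt {q : ℝ} (hq : 0 < q) {K : Finset ℝ} {m x : ℝ} (hm : m ∈ K)
    (hK : ∀ k ∈ K, k ≤ m) (hx : m < x) :
    benefit q K x = q * intervalValue ((x - m) / q) := by
  have hi := integrable_rightGain hq
  rw [benefit_eq_integral hq ⟨m, hm⟩ (gain_insert_of_gt hm hK hx),
    integral_add_sub (integrable_bridgeGain q m x) (hi.comp_sub_right x) (hi.comp_sub_right m),
    integral_sub_right_eq_self (rightGain q) x, integral_sub_right_eq_self (rightGain q) m,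
    integral_bridgeGain hq hx]
  ring

lemma benefit_of_lt {q : ℝ} (hq : 0 < q) {K : Finset ℝ} {m x : ℝ} (hm : m ∈ K)
    (hK : ∀ k ∈ K, m ≤ k) (hx : x < m) :
    benefit q K x = q * intervalValue ((m - x) / q) := by
  have hi := integrable_leftGain hq
  rw [benefit_eq_integral hq ⟨m, hm⟩ (gain_insert_of_lt hm hK hx),
    integral_add_sub (integrable_bridgeGain q x m) (hi.comp_sub_right x) (hi.comp_sub_right m),
    integral_sub_right_eq_self (leftGain q) x, integral_sub_right_eq_self (leftGain q) m,
    integral_bridgeGain hq hx]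
  ring

lemma benefit_of_mem {q : ℝ} {K : Finset ℝ} {x : ℝ} (hx : x ∈ K) : benefit q K x = 0 := by
  rw [benefit, Finset.insert_eq_of_mem hx, sub_self]

lemma novelty_eq {K : Finset ℝ} {x d : ℝ} (h1 : ∃ k ∈ K, |x - k| = d)
    (h2 : ∀ k ∈ K, d ≤ |x - k|) : novelty K x = d := by
  obtain ⟨k, hk, hd⟩ := h1
  apply le_antisymm
  · rw [← hd, ← Real.dist_eq]
    exact Metric.infDist_le_dist_of_mem (Finset.mem_coe.2 hk)
  · refine (Metric.le_infDist ⟨k, Finset.mem_coe.2 hk⟩).2 fun y hy => ?_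
    rw [Real.dist_eq]
    exact h2 y (Finset.mem_coe.1 hy)

lemma novelty_of_mem_Ico {K : Finset ℝ} {l r x : ℝ} (hl : l ∈ K)
    (hr : r ∈ K) (hK : ∀ k ∈ K, k ≤ l ∨ r ≤ k) (hx : x ∈ Set.Ico l r) :
    novelty K x = min (x - l) (r - x) := by
  have hx1 := hx.1
  have hx2 := hx.2
  apply novelty_eq
  · rcases min_choice (x - l) (r - x) with h | h
    · exact ⟨l, hl, by rw [h, abs_of_nonneg (by linarith)]⟩
    · exact ⟨r, hr, by rw [h, abs_sub_comm, abs_of_nonneg (by linarith)]⟩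
  · intro k hk
    rcases hK k hk with h | h
    · exact (min_le_left _ _).trans (le_abs.2 (Or.inl (by linarith)))
    · exact (min_le_right _ _).trans (le_abs.2 (Or.inr (by linarith)))

lemma novelty_of_ge {K : Finset ℝ} {m x : ℝ} (hm : m ∈ K) (hK : ∀ k ∈ K, k ≤ m) (hx : m ≤ x) :
    novelty K x = x - m :=
  novelty_eq ⟨m, hm, abs_of_nonneg (by linarith)⟩
    fun k hk => le_abs.2 (Or.inl (by linarith [hK k hk]))

lemma novelty_of_le {K : Finset ℝ} {m x : ℝ} (hm : m ∈ K) (hK : ∀ k ∈ K, m ≤ k) (hx : x ≤ m) :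
    novelty K x = m - x :=
  novelty_eq ⟨m, hm, by rw [abs_sub_comm, abs_of_nonneg (by linarith)]⟩
    fun k hk => le_abs.2 (Or.inr (by linarith [hK k hk]))

lemma bridgeVar_scale {q : ℝ} (hq : 0 < q) (d X : ℝ) :
    q * bridgeVar (d / q) (X / q) = d * (X - d) / X := by
  unfold bridgeVar
  by_cases hX : X = 0
  · simp [hX]
  · field_simp

/-- In a bounded area, benefit and variance are functions of the novelty. -/
lemma boundedArea_spec {q : ℝ} (hq : 0 < q) {K : Finset ℝ} {A : Set ℝ} {X : ℝ}
    (hA : IsBoundedArea K A X) :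
    0 < X ∧
    (∀ x ∈ A, 0 ≤ novelty K x ∧ novelty K x ≤ X / 2 ∧
      benefit q K x = q * splitValue (novelty K x / q) (X / q) ∧
      conjVar K x = q * bridgeVar (novelty K x / q) (X / q)) ∧
    (∀ d, 0 ≤ d → d ≤ X / 2 → ∃ x ∈ A, novelty K x = d) := by
  obtain ⟨l, hl, r, hr, hlr, hK, rfl, rfl⟩ := hA
  refine ⟨sub_pos.2 hlr, fun x hx => ?_, fun d h0 h2 => ?_⟩
  · have hx1 := hx.1
    have hx2 := hx.2
    have hb : benefit q K x = q * splitValue ((x - l) / q) ((r - l) / q) := by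
      rcases hx1.eq_or_lt with h | h
      · rw [benefit_of_mem (h ▸ hl), ← h, sub_self, zero_div, splitValue_zero, mul_zero]
      · exact benefit_of_mem_Ioo hq hl hr hK ⟨h, hx2⟩
    have hv : conjVar K x = q * bridgeVar ((x - l) / q) ((r - l) / q) := by
      rw [conjVar_of_mem_Ico hl hr hK hx, bridgeVar_scale hq]
      ring
    rw [novelty_of_mem_Ico hl hr hK hx]
    rcases le_total (x - l) (r - x) with h | h
    · rw [min_eq_left h]
      exact ⟨by linarith, by linarith, hb, hv⟩
    · rw [min_eq_right h]
      refine ⟨by linarith, by linarith, ?_, ?_⟩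
      · rw [hb, ← splitValue_symm]
        congr 2; ring
      · rw [hv, ← bridgeVar_symm]
        congr 2; ring
  · refine ⟨l + d, ⟨by linarith, by linarith⟩, ?_⟩
    rw [novelty_of_mem_Ico hl hr hK ⟨by linarith, by linarith⟩, add_sub_cancel_left]
    exact min_eq_left (by linarith)

/-- Beyond the frontier, benefit and variance are functions of the novelty. -/
lemma frontierArea_spec {q : ℝ} (hq : 0 < q) {K : Finset ℝ} {A : Set ℝ}
    (hA : IsFrontierArea K A) :
    (∀ x ∈ A, 0 ≤ novelty K x ∧ benefit q K x = q * intervalValue (novelty K x / q) ∧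
      conjVar K x = q * (novelty K x / q)) ∧
    (∀ d, 0 < d → ∃ x ∈ A, novelty K x = d) := by
  obtain ⟨hK, rfl | rfl⟩ := hA
  · have hm := K.min'_mem hK
    have hle : ∀ k ∈ K, K.min' hK ≤ k := fun k hk => K.min'_le k hk
    refine ⟨fun x hx => ?_, fun d hd => ⟨K.min' hK - d, ?_, ?_⟩⟩
    · have hx' : x < K.min' hK := hx
      rw [novelty_of_le hm hle hx'.le, benefit_of_lt hq hm hle hx', conjVar_of_lt hm hle hx',
        mul_div_cancel₀ _ hq.ne']
      exact ⟨by linarith, rfl, rfl⟩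
    · simp only [Set.mem_Iio]; linarith
    · rw [novelty_of_le hm hle (by linarith)]; ring
  · have hm := K.max'_mem hK
    have hle : ∀ k ∈ K, k ≤ K.max' hK := fun k hk => K.le_max' k hk
    refine ⟨fun x hx => ?_, fun d hd => ⟨K.max' hK + d, ?_, ?_⟩⟩
    · have hx' : K.max' hK ≤ x := hx
      rw [novelty_of_ge hm hle hx', conjVar_of_ge hm hle hx', mul_div_cancel₀ _ hq.ne']
      refine ⟨by linarith, ?_, rfl⟩
      rcases hx'.eq_or_lt with h | h
      · rw [benefit_of_mem (h ▸ hm), ← h, sub_self, zero_div, intervalValue_zero, mul_zero]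
      · exact benefit_of_gt hq hm hle h
    · simp only [Set.mem_Ici]; linarith
    · rw [novelty_of_ge hm hle (by linarith)]; ring

/-! ### From payoffs in the extended reals to the best payoff. -/

section payoff
variable {q η : ℝ} {K : Finset ℝ} {x : ℝ}

lemma payoff_erf (z : ℝ) : payoff q η K x (erf z) =
    ((erf z * benefit q K x - η * (z ^ 2 * conjVar K x) : ℝ) : EReal) := by
  rw [payoff, costFactor, if_pos (erf_lt_one z), erfInv_erf]
  push_cast
  rfl

lemma payoff_one (hη : 0 < η) (hS : 0 < conjVar K x) : payoff q η K x 1 = ⊥ := by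
  rw [payoff, costFactor, if_neg (lt_irrefl _), EReal.top_mul_coe_of_pos hS,
    EReal.coe_mul_top_of_pos hη, EReal.sub_top]

lemma payoff_optimal (hV : conjVar K x = 0 → benefit q K x = 0) :
    payoff q η K x (erf (optArg η (benefit q K x / conjVar K x))) =
      ((bestPayoff η (benefit q K x) (conjVar K x) : ℝ) : EReal) := by
  rw [payoff_erf, bestPayoff_eq hV]

lemma payoff_le (hη : 0 < η) (hS : 0 ≤ conjVar K x) (hV : conjVar K x = 0 → benefit q K x = 0)
    {ρ : ℝ} (hρ : ρ ∈ Set.Icc (0 : ℝ) 1) :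
    payoff q η K x ρ ≤ ((bestPayoff η (benefit q K x) (conjVar K x) : ℝ) : EReal) := by
  rcases hρ.2.eq_or_lt with h | h
  · subst h
    -- On a known question the infinite cost of `ρ = 1` is multiplied by variance `0`, and `⊤ * 0 =
    -- 0` makes the payoff `0`.
    rcases hS.eq_or_lt with h | h
    · simp [payoff, ← h, hV h.symm, bestPayoff]
    · rw [payoff_one hη h]; exact bot_le
  · obtain ⟨z, -, rfl⟩ := exists_erf_eq hρ.1 h
    rw [payoff_erf, EReal.coe_le_coe_iff]
    exact output_le_bestPayoff hη hS hV z

lemma bestOutputs_eq (hη : 0 < η) (hS : 0 < conjVar K x) (hV : 0 ≤ benefit q K x) :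
    bestOutputs q η K x = {erf (optArg η (benefit q K x / conjVar K x))} := by
  have hV0 : conjVar K x = 0 → benefit q K x = 0 := fun h => absurd h hS.ne'
  have hmem : erf (optArg η (benefit q K x / conjVar K x)) ∈ Set.Icc (0 : ℝ) 1 :=
    ⟨erf_nonneg (optArg_nonneg hη (div_nonneg hV hS.le)), (erf_lt_one _).le⟩
  ext ρ
  constructor
  · rintro ⟨hρ, hmax⟩
    have h1 : payoff q η K x (erf (optArg η (benefit q K x / conjVar K x))) ≤
      payoff q η K x ρ := hmax hmem
    rw [payoff_optimal hV0] at h1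
    rcases hρ.2.eq_or_lt with h | h
    · rw [h, payoff_one hη hS] at h1
      exact absurd (le_bot_iff.1 h1) (EReal.coe_ne_bot _)
    · obtain ⟨z, -, rfl⟩ := exists_erf_eq hρ.1 h
      by_contra hne
      have hz : z ≠ optArg η (benefit q K x / conjVar K x) := by
        rintro rfl; exact hne rfl
      rw [payoff_erf, EReal.coe_le_coe_iff] at h1
      exact absurd (output_lt_bestPayoff hη hS hz) (not_lt.2 h1)
  · intro h
    rw [Set.mem_singleton_iff] at h
    subst h
    refine ⟨hmem, fun ρ' hρ' => ?_⟩
    change payoff q η K x ρ' ≤ payoff q η K x _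
    rw [payoff_optimal hV0]
    exact payoff_le hη hS.le hV0 hρ'

end payoff

/-- The optimal choices of an area are found by maximizing the payoff of the best output. -/
lemma isOptimalChoice_spec {q η : ℝ} (hη : 0 < η) {K : Finset ℝ} {A : Set ℝ} {u : ℝ → ℝ}
    (hS : ∀ x ∈ A, 0 ≤ conjVar K x) (hV : ∀ x ∈ A, 0 ≤ benefit q K x)
    (hV0 : ∀ x ∈ A, conjVar K x = 0 → benefit q K x = 0)
    (hu : ∀ x ∈ A, bestPayoff η (benefit q K x) (conjVar K x) = u x) :
    (∀ x ρ, IsOptimalChoice q η K A x ρ → x ∈ A ∧ ∀ x' ∈ A, u x' ≤ u x) ∧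
    (∀ x ∈ A, (∀ x' ∈ A, u x' ≤ u x) → ∃ ρ, IsOptimalChoice q η K A x ρ) := by
  have hmem : ∀ x ∈ A, erf (optArg η (benefit q K x / conjVar K x)) ∈ Set.Icc (0 : ℝ) 1 :=
    fun x hx => ⟨erf_nonneg (optArg_nonneg hη (div_nonneg (hV x hx) (hS x hx))),
      (erf_lt_one _).le⟩
  constructor
  · rintro x ρ ⟨⟨hx, hρ⟩, hmax⟩
    refine ⟨hx, fun x' hx' => ?_⟩
    have h1 := hmax (Set.mk_mem_prod hx' (hmem x' hx'))
    change payoff q η K x' _ ≤ payoff q η K x ρ at h1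
    rw [payoff_optimal (hV0 x' hx')] at h1
    have h2 := h1.trans (payoff_le hη (hS x hx) (hV0 x hx) hρ)
    rw [EReal.coe_le_coe_iff, hu x hx, hu x' hx'] at h2
    exact h2
  · intro x hx hmax
    refine ⟨_, ⟨hx, hmem x hx⟩, ?_⟩
    rintro ⟨x', ρ'⟩ ⟨hx', hρ'⟩
    change payoff q η K x' ρ' ≤ payoff q η K x _
    rw [payoff_optimal (hV0 x hx)]
    refine (payoff_le hη (hS x' hx') (hV0 x' hx') hρ').trans ?_
    rw [EReal.coe_le_coe_iff, hu x hx, hu x' hx']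
    exact hmax x' hx'

/-- Homogeneity of degree one, which reduces every maximization to tolerance 1 with the same `η`. -/
lemma bestPayoff_scale {q : ℝ} (hq : 0 < q) (η V S : ℝ) :
    bestPayoff η (q * V) (q * S) = q * bestPayoff η V S := by
  unfold bestPayoff
  rw [mul_div_mul_left _ _ hq.ne', mul_assoc]

section bounded
variable {q η : ℝ} (hq : 0 < q) (hη : 0 < η) {K : Finset ℝ} {A : Set ℝ} {X : ℝ}
  (hA : IsBoundedArea K A X)
include hq hη hA

lemma isOptimalOutput_bounded {S : Set ℝ} (hS : ∀ d ∈ S, 0 < d) :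
    IsOptimalOutput q η K A S (fun d => erf (optArg η (splitRatio (d / q) (X / q)))) := by
  obtain ⟨hX, hspec, -⟩ := boundedArea_spec hq hA
  intro x hx hd
  obtain ⟨h0, h2, hb, hv⟩ := hspec x hx
  have hd0 := div_pos (hS _ hd) hq
  have hd1 : novelty K x / q < X / q := div_lt_div_of_pos_right (by linarith) hq
  have hs := bridgeVar_pos hd0 hd1
  have hsv := splitValue_pos hd0 hd1
  rw [bestOutputs_eq hη (by rw [hv]; positivity) (by rw [hb]; positivity), hb, hv,
    mul_div_mul_left _ _ hq.ne']
  rfl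

omit hη hA in
lemma div_mem_Ioc {d : ℝ} (hd : d ∈ Set.Ioc 0 (X / 2)) : d / q ∈ Set.Ioc 0 (X / q / 2) := by
  refine ⟨div_pos hd.1 hq, ?_⟩
  rw [div_right_comm]
  exact div_le_div_of_nonneg_right hd.2 hq.le

lemma complements_bounded {S T : Set ℝ} (hS : ∀ d ∈ S, 0 < d ∧ d / q ∈ T)
    (hR : StrictMonoOn (fun d => splitRatio d (X / q)) T) : Complements q η K A S :=
  ⟨_, isOptimalOutput_bounded hq hη hA fun d hd => (hS d hd).1, fun _ ha _ hb hab =>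
    strictMono_erf (strictMono_optArg hη (hR (hS _ ha).2 (hS _ hb).2
      (div_lt_div_of_pos_right hab hq)))⟩

lemma substitutes_bounded {S T : Set ℝ} (hS : ∀ d ∈ S, 0 < d ∧ d / q ∈ T)
    (hR : StrictAntiOn (fun d => splitRatio d (X / q)) T) : Substitutes q η K A S :=
  ⟨_, isOptimalOutput_bounded hq hη hA fun d hd => (hS d hd).1, fun _ ha _ hb hab =>
    strictMono_erf (strictMono_optArg hη (hR (hS _ ha).2 (hS _ hb).2
      (div_lt_div_of_pos_right hab hq)))⟩

lemma independent_bounded (hX : X ≤ 4 * q) : Independent q η K A (Set.Ioc 0 (X / 2)) := by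
  refine ⟨_, isOptimalOutput_bounded hq hη hA fun d hd => hd.1, fun d hd d' hd' => ?_⟩
  have h4 : X / q ≤ 4 := by rwa [div_le_iff₀ hq]
  have h1 := div_mem_Ioc hq hd
  have h2 := div_mem_Ioc hq hd'
  rw [splitRatio_of_le h1.1 (by linarith [h1.1, h1.2]) h4,
    splitRatio_of_le h2.1 (by linarith [h2.1, h2.2]) h4]

lemma isOptimalChoice_bounded :
    (∀ x ρ, IsOptimalChoice q η K A x ρ → x ∈ A ∧ ∀ d, 0 ≤ d → d ≤ X / 2 →
      boundedPayoff η (d / q) (X / q) ≤ boundedPayoff η (novelty K x / q) (X / q)) ∧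
    (∀ d, 0 ≤ d → d ≤ X / 2 → (∀ d', 0 ≤ d' → d' ≤ X / 2 →
      boundedPayoff η (d' / q) (X / q) ≤ boundedPayoff η (d / q) (X / q)) →
      ∃ x ρ, IsOptimalChoice q η K A x ρ ∧ novelty K x = d) := by
  obtain ⟨hX, hspec, hsurj⟩ := boundedArea_spec hq hA
  have hcase : ∀ x ∈ A, novelty K x = 0 ∨
      (0 < novelty K x / q ∧ novelty K x / q < X / q) := by
    intro x hx
    obtain ⟨h0, h2, -, -⟩ := hspec x hx
    rcases h0.eq_or_lt with h | h
    · exact Or.inl h.symm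
    · exact Or.inr ⟨div_pos h hq, div_lt_div_of_pos_right (by linarith) hq⟩
  obtain ⟨c1, c2⟩ := isOptimalChoice_spec (q := q) (K := K) (A := A) hη
    (u := fun x => q * boundedPayoff η (novelty K x / q) (X / q))
    (fun x hx => by
      obtain ⟨-, -, hb, hv⟩ := hspec x hx
      rcases hcase x hx with h | h
      · rw [hv, h, zero_div, bridgeVar_zero, mul_zero]
      · rw [hv]; exact (mul_pos hq (bridgeVar_pos h.1 h.2)).le)
    (fun x hx => by
      obtain ⟨-, -, hb, hv⟩ := hspec x hx
      rcases hcase x hx with h | h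
      · rw [hb, h, zero_div, splitValue_zero, mul_zero]
      · rw [hb]; exact (mul_pos hq (splitValue_pos h.1 h.2)).le)
    (fun x hx h0 => by
      obtain ⟨-, -, hb, hv⟩ := hspec x hx
      rcases hcase x hx with h | h
      · rw [hb, h, zero_div, splitValue_zero, mul_zero]
      · exact absurd h0 (by rw [hv]; exact (mul_pos hq (bridgeVar_pos h.1 h.2)).ne'))
    (fun x hx => by
      obtain ⟨-, -, hb, hv⟩ := hspec x hx
      rw [hb, hv, bestPayoff_scale hq]; rfl)
  constructor
  · intro x ρ h
    obtain ⟨hx, hmax⟩ := c1 x ρ h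
    refine ⟨hx, fun d h0 h2 => ?_⟩
    obtain ⟨x', hx', rfl⟩ := hsurj d h0 h2
    exact le_of_mul_le_mul_left (hmax x' hx') hq
  · intro d h0 h2 hmax
    obtain ⟨x, hx, rfl⟩ := hsurj d h0 h2
    obtain ⟨ρ, hρ⟩ := c2 x hx fun x' hx' =>
      mul_le_mul_of_nonneg_left (hmax _ (hspec x' hx').1 (hspec x' hx').2.1) hq.le
    exact ⟨x, ρ, hρ, rfl⟩

lemma exists_isOptimalChoice_bounded : ∃ x ρ, IsOptimalChoice q η K A x ρ := by
  obtain ⟨hX, -, -⟩ := boundedArea_spec hq hA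
  obtain ⟨d, h0, h2, hmax⟩ := exists_max_boundedPayoff hη (div_pos hX hq)
  have hXq : X / q * q = X := div_mul_cancel₀ _ hq.ne'
  obtain ⟨x, ρ, h, -⟩ := (isOptimalChoice_bounded hq hη hA).2 (d * q) (by positivity)
    (by have := mul_le_mul_of_nonneg_right h2 hq.le; linarith) (by
      intro d' h0' h2'
      rw [mul_div_cancel_right₀ _ hq.ne']
      exact hmax _ (div_nonneg h0' hq.le)
        (div_le_div_of_nonneg_right (by linarith) hq.le))
  exact ⟨x, ρ, h⟩

end bounded

section frontier
variable {q η : ℝ} (hq : 0 < q) (hη : 0 < η) {K : Finset ℝ} {A : Set ℝ}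
  (hA : IsFrontierArea K A)
include hq hη hA

lemma substitutes_frontier : Substitutes q η K A (Set.Ioi 0) := by
  refine ⟨fun d => erf (optArg η (intervalValue (d / q) / (d / q))), ?_, ?_⟩
  · intro x hx hd
    obtain ⟨h0, hb, hv⟩ := (frontierArea_spec hq hA).1 x hx
    have hd0 : 0 < novelty K x / q := div_pos hd hq
    have := intervalValue_pos hd0
    rw [bestOutputs_eq hη (by rw [hv]; positivity) (by rw [hb]; positivity), hb, hv,
      mul_div_mul_left _ _ hq.ne']
  · intro a ha b hb hab
    exact strictMono_erf (strictMono_optArg hη (strictAntiOn_intervalValue_div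
      (Set.mem_Ioi.2 (div_pos ha hq)) (Set.mem_Ioi.2 (div_pos hb hq))
      (div_lt_div_of_pos_right hab hq)))

lemma isOptimalChoice_frontier :
    (∃ x ρ, IsOptimalChoice q η K A x ρ) ∧
    (∀ x ρ, IsOptimalChoice q η K A x ρ → novelty K x ∈ Set.Ioo (2 * q) (3 * q)) := by
  obtain ⟨hspec, hsurj⟩ := frontierArea_spec hq hA
  obtain ⟨c1, c2⟩ := isOptimalChoice_spec (q := q) (K := K) (A := A) hη
    (u := fun x => q * frontierPayoff η (novelty K x / q))
    (fun x hx => by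
      obtain ⟨h0, hb, hv⟩ := hspec x hx
      rw [hv]; positivity)
    (fun x hx => by
      obtain ⟨h0, hb, hv⟩ := hspec x hx
      rw [hb]; exact mul_nonneg hq.le (intervalValue_nonneg (div_nonneg h0 hq.le)))
    (fun x hx h => by
      obtain ⟨h0, hb, hv⟩ := hspec x hx
      have hz : novelty K x / q = 0 := by
        rw [hv] at h
        exact (mul_eq_zero.1 h).resolve_left hq.ne'
      rw [hb, hz, intervalValue_zero, mul_zero])
    (fun x hx => by
      obtain ⟨h0, hb, hv⟩ := hspec x hx
      rw [hb, hv, bestPayoff_scale hq]; rfl)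
  constructor
  · obtain ⟨d, h0, hmax⟩ := exists_max_frontierPayoff hη
    have hd := max_frontierPayoff_mem hη h0 hmax
    obtain ⟨x, hx, hxd⟩ := hsurj (d * q) (mul_pos (by linarith [hd.1]) hq)
    obtain ⟨ρ, hρ⟩ := c2 x hx fun x' hx' => by
      rw [hxd, mul_div_cancel_right₀ _ hq.ne']
      exact mul_le_mul_of_nonneg_left (hmax _ (div_nonneg (hspec x' hx').1 hq.le)) hq.le
    exact ⟨x, ρ, hρ⟩
  · intro x ρ h
    obtain ⟨hx, hmax⟩ := c1 x ρ h
    have h0 := div_nonneg (hspec x hx).1 hq.le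
    have hd := max_frontierPayoff_mem hη h0 fun d' hd' => by
      rcases hd'.eq_or_lt with h | h
      · rw [← h, frontierPayoff_zero]
        exact bestPayoff_nonneg hη h0 (intervalValue_nonneg h0)
      · obtain ⟨x', hx', hxd⟩ := hsurj (d' * q) (mul_pos h hq)
        have := hmax x' hx'
        rw [hxd, mul_div_cancel_right₀ _ hq.ne'] at this
        exact le_of_mul_le_mul_left this hq
    exact ⟨(lt_div_iff₀ hq).1 hd.1, (div_lt_iff₀ hq).1 hd.2⟩

end frontier

lemma dHat_scale {q : ℝ} (hq : 0 < q) (X : ℝ) : dHat q X = q * dHat 1 (X / q) := by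
  have hs : Real.sqrt ((18 * q ^ 2 - 8 * q * X + X ^ 2) / 2) =
      q * Real.sqrt ((18 * 1 ^ 2 - 8 * 1 * (X / q) + (X / q) ^ 2) / 2) := by
    rw [← Real.sqrt_sq hq.le, ← Real.sqrt_mul (sq_nonneg _), Real.sqrt_sq hq.le]
    congr 1
    field_simp
  unfold dHat
  rw [hs]
  rw [show X - 6 * q = q * (X / q - 6 * 1) by field_simp]
  generalize Real.sqrt ((18 * 1 ^ 2 - 8 * 1 * (X / q) + (X / q) ^ 2) / 2) = s
  obtain ⟨Y, rfl⟩ : ∃ Y, X = q * Y := ⟨X / q, by field_simp⟩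
  rw [mul_div_cancel_left₀ _ hq.ne', div_mul_eq_div_div]
  field_simp

end ResearchModel

open ResearchModel
theorem mainTheorem2 (q η : ℝ) (hq : 0 < q) (hη : 0 < η) :
    (∀ (K : Finset ℝ) (A : Set ℝ), IsFrontierArea K A →
      Substitutes q η K A (Set.Ioi 0) ∧
      (∃ x ρ, IsOptimalChoice q η K A x ρ) ∧
      (∀ x ρ, IsOptimalChoice q η K A x ρ → novelty K x ∈ Set.Ioo (2 * q) (3 * q))) ∧
    (∀ (K : Finset ℝ) (A : Set ℝ) (X : ℝ), IsBoundedArea K A X →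
      (X ≤ 4 * q → Independent q η K A (Set.Ioc 0 (X / 2))) ∧
      (X ∈ Set.Ioo (4 * q) ((4 + Real.sqrt 6) * q) → Complements q η K A (Set.Ioc 0 (X / 2))) ∧
      (X ∈ Set.Ioo ((4 + Real.sqrt 6) * q) (8 * q) →
        dHat q X ∈ Set.Ioo 0 (X / 2) ∧
        Substitutes q η K A (Set.Ioo 0 (dHat q X)) ∧
        Complements q η K A (Set.Ioo (dHat q X) (X / 2))) ∧
      (8 * q < X → Substitutes q η K A (Set.Ioc 0 (X / 2)))) ∧
    (∃ Xt ∈ Set.Ioo (4 * q) (8 * q),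
      ∀ (K : Finset ℝ) (A : Set ℝ) (X : ℝ), IsBoundedArea K A X →
        (∃ x ρ, IsOptimalChoice q η K A x ρ) ∧
        (X ≤ Xt → ∃ x ρ, IsOptimalChoice q η K A x ρ ∧ novelty K x = X / 2) ∧
        (X < Xt → ∀ x ρ, IsOptimalChoice q η K A x ρ → novelty K x = X / 2) ∧
        (Xt < X → ∀ x ρ, IsOptimalChoice q η K A x ρ → novelty K x ∈ Set.Ioo 0 (X / 2))) := by
  refine ⟨fun K A hA => ⟨substitutes_frontier hq hη hA, isOptimalChoice_frontier hq hη hA⟩,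
    fun K A X hA => ⟨independent_bounded hq hη hA, fun hX => ?_, fun hX => ?_, fun hX => ?_⟩, ?_⟩
  · exact complements_bounded hq hη hA (fun d hd => ⟨hd.1, div_mem_Ioc hq hd⟩)
      (strictMonoOn_splitRatio ((lt_div_iff₀ hq).2 hX.1) ((div_lt_iff₀ hq).2 hX.2).le)
  · have h1 := (lt_div_iff₀ hq).2 hX.1
    have h2 := (div_lt_iff₀ hq).2 hX.2
    obtain ⟨p1, p2, -, -⟩ := dHat_spec h1 h2
    rw [dHat_scale hq]
    refine ⟨⟨mul_pos hq p1, ?_⟩, ?_, ?_⟩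
    · have h3 : dHat 1 (X / q) < X / q / 2 := by linarith
      have h4 := mul_lt_mul_of_pos_left h3 hq
      rwa [← mul_div_assoc, mul_div_cancel₀ _ hq.ne'] at h4
    · exact substitutes_bounded hq hη hA (T := Set.Ioc 0 (dHat 1 (X / q))) (fun d hd => ⟨hd.1, div_pos hd.1 hq,
        (div_le_iff₀' hq).2 hd.2.le⟩) (strictAntiOn_splitRatio_dHat h1 h2)
    · exact complements_bounded hq hη hA (T := Set.Icc (dHat 1 (X / q)) (X / q / 2)) (fun d hd =>
        have h0 := (mul_pos hq p1).trans hd.1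
        ⟨h0, (le_div_iff₀' hq).2 hd.1.le, (div_mem_Ioc hq ⟨h0, hd.2.le⟩).2⟩)
        (strictMonoOn_splitRatio_dHat h1 h2)
  · exact substitutes_bounded hq hη hA (fun d hd => ⟨hd.1, div_mem_Ioc hq hd⟩)
      (strictAntiOn_splitRatio ((lt_div_iff₀ hq).2 hX))
  · obtain ⟨Xt, hXt, hcut⟩ := exists_cutoff hη
    -- `Xt` comes from `η` alone, before any `K` is chosen, so one cutoff serves all knowledge.
    refine ⟨Xt * q, ⟨mul_lt_mul_of_pos_right hXt.1 hq, mul_lt_mul_of_pos_right hXt.2 hq⟩,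
      fun K A X hA => ⟨exists_isOptimalChoice_bounded hq hη hA, fun h => ?_, fun h x ρ hxρ => ?_,
        fun h x ρ hxρ => ?_⟩⟩
    all_goals
      obtain ⟨hX, hspec, -⟩ := boundedArea_spec hq hA
      have hXq := div_pos hX hq
      obtain ⟨k1, k2, k3⟩ := hcut _ hXq
      obtain ⟨c1, c2⟩ := isOptimalChoice_bounded hq hη hA
      have hmid : X / 2 / q = X / q / 2 := div_right_comm _ _ _
    · refine c2 (X / 2) (by linarith) le_rfl fun d h0 h2 => ?_
      rw [hmid]
      rcases h0.eq_or_lt with h0 | h0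
      · rw [← h0, zero_div, boundedPayoff_zero]
        exact (boundedPayoff_pos hη (by linarith) (by linarith)).le
      rcases h2.eq_or_lt with h2 | h2
      · rw [h2, hmid]
      · exact k1 ((div_le_iff₀ hq).2 h) _ (div_pos h0 hq)
          (hmid ▸ div_lt_div_of_pos_right h2 hq)
    · obtain ⟨hx, hmax⟩ := c1 x ρ hxρ
      obtain ⟨h0, h2, -, -⟩ := hspec x hx
      by_contra hne
      have hlt := lt_of_le_of_ne h2 hne
      have hm := hmax (X / 2) (by linarith) le_rfl
      rw [hmid] at hm
      rcases h0.eq_or_lt with h0 | h0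
      · rw [← h0, zero_div, boundedPayoff_zero] at hm
        exact absurd (boundedPayoff_pos hη (by linarith) (by linarith)) (not_lt.2 hm)
      · exact absurd (k2 ((div_lt_iff₀ hq).2 h) _ (div_pos h0 hq)
          (hmid ▸ div_lt_div_of_pos_right hlt hq)) (not_lt.2 hm)
    · obtain ⟨hx, hmax⟩ := c1 x ρ hxρ
      obtain ⟨h0, h2, -, -⟩ := hspec x hx
      constructor
      · refine lt_of_le_of_ne h0 fun h0 => ?_
        have hm := hmax (X / 2) (by linarith) le_rfl
        rw [hmid, ← h0, zero_div, boundedPayoff_zero] at hm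
        exact absurd (boundedPayoff_pos hη (by linarith) (by linarith)) (not_lt.2 hm)
      · refine lt_of_le_of_ne h2 fun h2 => ?_
        obtain ⟨d, d0, d2, hd⟩ := k3 ((lt_div_iff₀ hq).2 h)
        have hdq : d * q ≤ X / 2 := by
          rw [← le_div_iff₀ hq, hmid]; exact d2.le
        have hm := hmax (d * q) (by positivity) hdq
        rw [h2, hmid, mul_div_cancel_right₀ _ hq.ne'] at hm
        exact absurd hd (not_lt.2 hm)
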